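/- For points $F_1,F_2$ of the Euclidean plane and a real $s>|F_1F_2|$ let $E_s(F_1,F_2)=\{p:|pF_1|+|pF_2|=s\}$ be the ellipse with foci $F_1,F_2$ (a circle if $F_1=F_2$); ellipses with the same foci are called confocal. A line is tangent to an ellipse if it meets it in exactly one point. Let $n\ge 1$. (a) A billiard trajectory in an ellipse $\Gamma$ is a sequence of points $x_0,x_1,x_2,\dots$ of $\Gamma$ with $x_{i+1}\ne x_i$ such that, for every $i\ge 0$, the direction of $x_{i+2}-x_{i+1}$ is the mirror image of the direction of $x_{i+1}-x_i$ in the tangent line of $\Gamma$ at $x_{i+1}$. It is tangent to an ellipse $\gamma$ confocal to $\Gamma$ if one of the lines $x_ix_{i+1}$ is tangent to $\gamma$ (all of them are then tangent to $\gamma$), and it is $n$-periodic if $x_{i+n}=x_i$ for all $i$. Let $\Gamma$ and $\gamma$ be confocal ellipses. If some billiard trajectory in $\Gamma$ tangent to $\gamma$ is $n$-periodic, then every billiard trajectory in $\Gamma$ tangent to $\gamma$ is $n$-periodic. (b) The billiard ball map $T_\Gamma$ of an ellipse $\Gamma$ sends an oriented line $\ell$ that meets $\Gamma$ to the oriented line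 $\ell'$ that passes through the last point $y$ of $\ell$ on $\Gamma$ and whose direction is the mirror image of that of $\ell$ in the tangent line of $\Gamma$ at $y$. Let $\Gamma_1,\dots,\Gamma_k$ and $\gamma$ be confocal ellipses, with $\gamma$ inside every $\Gamma_j$, and let $T=T_{\Gamma_k}\circ\dots\circ T_{\Gamma_1}$. If $T^n\ell=\ell$ for some oriented line $\ell$ tangent to $\gamma$, then $T^n\ell'=\ell'$ for every oriented line $\ell'$ tangent to $\gamma$. (c) (Poncelet porism) Let $\Gamma$ and $\gamma$ be two ellipses, not necessarily confocal, with $\gamma$ contained in the open region bounded by $\Gamma$. Consider sequences $x_0,x_1,x_2,\dots$ of points of $\Gamma$ such that, for every $i\ge 0$, $x_{i+1}\ne x_i$, the line $x_ix_{i+1}$ is tangent to $\gamma$, and $x_{i+2}\ne x_i$. If $x_n=x_0$ for one such sequence $(x_i)$, then every such sequence $(y_i)$ satisfies $y_{i+n}=y_i$ for all $i\ge 0$. -/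

import Mathlib

noncomputable section

/-- The Euclidean plane. -/
abbrev Plane : Type := EuclideanSpace ℝ (Fin 2)

/-- The locus of points whose distances to the foci `F₁`, `F₂` have sum `s`. It is an ellipse when
`dist F₁ F₂ < s`, and a circle when moreover `F₁ = F₂`. Ellipses with the same foci are
confocal. -/
def ellipse (F₁ F₂ : Plane) (s : ℝ) : Set Plane :=
  {p | dist p F₁ + dist p F₂ = s}

/-- The open region bounded by `ellipse F₁ F₂ s`. -/
def ellipseInterior (F₁ F₂ : Plane) (s : ℝ) : Set Plane :=
  {p | dist p F₁ + dist p F₂ < s}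

/-- `L` is a straight line tangent at `y` to the ellipse `E`: it meets `E` at `y` and nowhere
else. -/
def IsTangentAt (E : Set Plane) (L : AffineSubspace ℝ Plane) (y : Plane) : Prop :=
  Module.finrank ℝ L.direction = 1 ∧ (L : Set Plane) ∩ E = {y}

/-- `L` is a straight line tangent to the ellipse `E`. -/
def IsTangent (E : Set Plane) (L : AffineSubspace ℝ Plane) : Prop :=
  ∃ y, IsTangentAt E L y

/-- The law of reflection at the point `y` of `E`: the outgoing direction `w` is that of the mirror
image of the incoming direction `u` in the tangent line of `E` at `y`. -/
def Reflects (E : Set Plane) (y u w : Plane) : Prop :=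
  ∃ L : AffineSubspace ℝ Plane, IsTangentAt E L y ∧ SameRay ℝ (L.direction.reflection u) w

/-- `x 0, x 1, x 2, …` are the successive impact points of a billiard trajectory inside `E`. -/
def IsBilliardTrajectory (E : Set Plane) (x : ℕ → Plane) : Prop :=
  (∀ i, x i ∈ E) ∧ (∀ i, x (i + 1) ≠ x i) ∧
    ∀ i, Reflects E (x (i + 1)) (x (i + 1) - x i) (x (i + 2) - x (i + 1))

/-- The trajectory with impact points `x` has a segment whose line is tangent to `E`. For a
trajectory inside an ellipse confocal to `E`, all segments are then tangent to `E`. -/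
def IsTangentTrajectory (E : Set Plane) (x : ℕ → Plane) : Prop :=
  ∃ i, IsTangent E (AffineSubspace.mk' (x i) (Submodule.span ℝ {x (i + 1) - x i}))

/-- An oriented line of the plane: a line together with a unit vector that directs it. -/
@[ext]
structure OrientedLine where
  line : AffineSubspace ℝ Plane
  dir : Plane
  norm_dir : ‖dir‖ = 1
  line_eq : ∃ p, line = AffineSubspace.mk' p (Submodule.span ℝ {dir})

/-- The billiard in `E` sends the oriented line `ℓ` to `ℓ'`: `ℓ` leaves the table at the point `y`
of `E` (its last point on `E`), and `ℓ'` is the line through `y` into which `ℓ` is reflected. -/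
def BilliardStep (E : Set Plane) (ℓ ℓ' : OrientedLine) : Prop :=
  ∃ y, y ∈ E ∧ y ∈ ℓ.line ∧ (∀ r : ℝ, 0 < r → y + r • ℓ.dir ∉ E) ∧
    y ∈ ℓ'.line ∧ Reflects E y ℓ.dir ℓ'.dir

open Classical in
/-- The billiard ball map of `E` on oriented lines. For an ellipse `E` the line `ℓ'` with
`BilliardStep E ℓ ℓ'` exists and is unique as soon as `ℓ` meets `E`; lines that miss `E` are left
where they are. -/
def billiardMap (E : Set Plane) (ℓ : OrientedLine) : OrientedLine :=
  if h : ∃ ℓ', BilliardStep E ℓ ℓ' then h.choose else ℓ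

/-- The composition of the billiard ball maps of the ellipses with foci `F₁`, `F₂` and distance
sums `s 0, …, s (k - 1)`, that of `s 0` being applied first. -/
def billiardComposition (F₁ F₂ : Plane) {k : ℕ} (s : Fin k → ℝ) : OrientedLine → OrientedLine :=
  (List.ofFn s).foldl (fun f r => billiardMap (ellipse F₁ F₂ r) ∘ f) id

/-- `x 0, x 1, x 2, …` are the successive vertices of a polygonal line inscribed in `E` and
circumscribed about `C`: each side lies on a line tangent to `C`, and from each vertex one
continues along the other tangent line. -/
def IsPonceletLine (E C : Set Plane) (x : ℕ → Plane) : Prop :=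
  (∀ i, x i ∈ E) ∧ (∀ i, x (i + 1) ≠ x i) ∧
    (∀ i, IsTangent C (AffineSubspace.mk' (x i) (Submodule.span ℝ {x (i + 1) - x i}))) ∧
    ∀ i, x (i + 2) ≠ x i

end

/-!
In an affine chart that makes the inner ellipse `γ` the unit circle, its tangents are parametrized
by an angle `θ`, and the outer ellipse becomes a conic that surrounds the circle. The Poncelet map
sends `θ` to the second tangent through the point where the tangent at `θ` leaves this conic.
While the tangent moves, the velocity of that exit point is tangent to the conic. Along either of
the two tangents of the circle through the point, the conic has a derivative equal up to sign to
the square root of the discriminant of its restriction to that tangent. Hence the Poncelet map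
preserves the density `dθ / √disc`. A circle map that preserves a positive density is a
translation in the coordinate that integrates it, so it is the identity as soon as it has a fixed
point; this applies to the iterates of the Poncelet map.

For an outer ellipse confocal to `γ`, the discriminant depends on the outer ellipse only through a
constant factor. The Poncelet maps of all the ellipses confocal to `γ` therefore preserve the same
density, and so do their compositions. By the optical property they are the billiard ball maps on
the tangents of `γ`.
-/

noncomputable section

open Real

/-! ### Circle maps that preserve a density -/

/-- The circle map `f` preserves the density `dθ / w θ`. The derivative is that of a lift of `f` to
the real line. -/
def PreservesDensity (w : Angle → ℝ) (f : Angle → Angle) : Prop :=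
  ∃ F : ℝ → ℝ, ∀ φ : ℝ, (F φ : Angle) = f φ ∧ HasDerivAt F (w (f φ) / w φ) φ

theorem hasDerivAt_integral_inv {w : Angle → ℝ} (hw : Continuous w) (hpos : ∀ θ, 0 < w θ)
    (φ : ℝ) : HasDerivAt (fun x : ℝ => ∫ ψ in (0 : ℝ)..x, (w ψ)⁻¹) (w φ)⁻¹ φ := by
  have hc : Continuous fun x : ℝ => (w x)⁻¹ :=
    (hw.comp Angle.continuous_coe).inv₀ fun x => (hpos x).ne'
  exact intervalIntegral.integral_hasDerivAt_right (hc.intervalIntegrable _ _)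
    hc.aestronglyMeasurable.stronglyMeasurableAtFilter hc.continuousAt

namespace PreservesDensity

variable {w : Angle → ℝ} {f g : Angle → Angle}

theorem id (hpos : ∀ θ, 0 < w θ) : PreservesDensity w id :=
  ⟨fun φ => φ, fun φ => ⟨rfl, by simpa [(hpos φ).ne'] using hasDerivAt_id' φ⟩⟩

theorem comp (hpos : ∀ θ, 0 < w θ) (hf : PreservesDensity w f) (hg : PreservesDensity w g) :
    PreservesDensity w (f ∘ g) := by
  obtain ⟨F, hF⟩ := hf
  obtain ⟨G, hG⟩ := hg
  refine ⟨F ∘ G, fun φ => ⟨?_, ?_⟩⟩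
  · rw [Function.comp_apply, (hF _).1, (hG φ).1, Function.comp_apply]
  · refine ((hF (G φ)).2.comp φ (hG φ).2).congr_deriv ?_
    rw [(hG φ).1, div_mul_div_cancel₀ (hpos _).ne', Function.comp_apply]

theorem iterate (hpos : ∀ θ, 0 < w θ) (hf : PreservesDensity w f) (n : ℕ) :
    PreservesDensity w f^[n] := by
  induction n with
  | zero => exact .id hpos
  | succ n ih => rw [Function.iterate_succ]; exact ih.comp hpos hf

/-- In the coordinate `∫ dθ / w θ` the map is a translation, and a translation with a fixed point is
the identity. -/
theorem eq_self_of_isFixedPt (hw : Continuous w) (hpos : ∀ θ, 0 < w θ) (hf : PreservesDensity w f)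
    {θ₀ : Angle} (h₀ : f θ₀ = θ₀) (θ : Angle) : f θ = θ := by
  obtain ⟨F, hF⟩ := hf
  induction θ₀ using Angle.induction_on with | _ φ₀
  induction θ using Angle.induction_on with | _ φ
  let W : ℝ → ℝ := fun x => ∫ ψ in (0 : ℝ)..x, (w ψ)⁻¹
  have hW : ∀ x : ℝ, HasDerivAt W (w x)⁻¹ x := hasDerivAt_integral_inv hw hpos
  have hWmono : StrictMono W := strictMono_of_deriv_pos fun x => by
    rw [(hW x).deriv]; exact inv_pos.2 (hpos x)
  let p : ℝ := F φ₀ - φ₀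
  have hp (x : ℝ) : ((x + p : ℝ) : Angle) = x := by
    rw [Angle.coe_add, Angle.coe_sub, (hF φ₀).1, h₀, sub_self, add_zero]
  have hderiv (x : ℝ) : HasDerivAt (fun x => W (F x) - W (x + p)) 0 x := by
    refine (((hW (F x)).comp x (hF x).2).sub ((hW (x + p)).comp_add_const x p)).congr_deriv ?_
    rw [(hF x).1, hp, ← mul_div_assoc, inv_mul_cancel₀ (hpos _).ne', one_div, sub_self]
  have hconst : W (F φ) - W (φ + p) = W (F φ₀) - W (φ₀ + p) :=
    is_const_of_deriv_eq_zero (fun x => (hderiv x).differentiableAt) (fun x => (hderiv x).deriv)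
      φ φ₀
  have hlift : F φ = φ + p := hWmono.injective <| by
    rw [← sub_eq_zero, hconst, add_sub_cancel, sub_self]
  rw [← (hF φ).1, hlift, hp]

theorem of_const_mul {k : ℝ} (hk : k ≠ 0) (hf : PreservesDensity (fun θ => k * w θ) f) :
    PreservesDensity w f := by
  simpa only [PreservesDensity, mul_div_mul_left _ _ hk] using hf

end PreservesDensity

/-- One and the same circle map, which preserves the density `dθ / w θ`, describes the self-map `g`
of `X` in each of the circle families `T i` of points of `X`. -/
def PreservesDensityAlong {ι X : Type*} (w : Angle → ℝ) (T : ι → Angle → X) (g : X → X) : Prop :=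
  ∃ f, PreservesDensity w f ∧ ∀ i, Function.Semiconj (T i) f g

namespace PreservesDensityAlong

variable {ι X : Type*} {w : Angle → ℝ} {T : ι → Angle → X} {g g' : X → X}

theorem id (hpos : ∀ θ, 0 < w θ) : PreservesDensityAlong w T id :=
  ⟨_, .id hpos, fun _ => .id_right⟩

theorem comp (hpos : ∀ θ, 0 < w θ) (hg : PreservesDensityAlong w T g)
    (hg' : PreservesDensityAlong w T g') : PreservesDensityAlong w T (g ∘ g') := by
  obtain ⟨f, hf, hs⟩ := hg
  obtain ⟨f', hf', hs'⟩ := hg'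
  exact ⟨f ∘ f', hf.comp hpos hf', fun i => (hs i).comp_right (hs' i)⟩

theorem iterate (hpos : ∀ θ, 0 < w θ) (hg : PreservesDensityAlong w T g) (n : ℕ) :
    PreservesDensityAlong w T g^[n] := by
  obtain ⟨f, hf, hs⟩ := hg
  exact ⟨f^[n], hf.iterate hpos n, fun i => (hs i).iterate_right n⟩

theorem isFixedPt (hw : Continuous w) (hpos : ∀ θ, 0 < w θ)
    (hT : ∀ i, Function.Injective (T i)) (hg : PreservesDensityAlong w T g) {i : ι} {θ₀ : Angle}
    (h₀ : Function.IsFixedPt g (T i θ₀)) (j : ι) (θ : Angle) : Function.IsFixedPt g (T j θ) := by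
  obtain ⟨f, hf, hs⟩ := hg
  have hfix : f θ₀ = θ₀ := hT i (((hs i).eq θ₀).trans h₀)
  rw [Function.IsFixedPt, ← (hs j).eq, hf.eq_self_of_isFixedPt hw hpos hfix]

end PreservesDensityAlong

/-! ### Tangents of the unit circle -/

/-- The point of the unit circle at the angle `θ`. -/
def circlePoint (θ : Angle) : ℝ × ℝ := (θ.cos, θ.sin)

/-- The counterclockwise unit tangent vector of the unit circle at the angle `θ`. -/
def tangentDir (θ : Angle) : ℝ × ℝ := (-θ.sin, θ.cos)

/-- The point with signed distance `r` from the point of contact on the tangent of the unit circle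
at the angle `θ`. -/
def tangentPoint (θ : Angle) (r : ℝ) : ℝ × ℝ := circlePoint θ + r • tangentDir θ

theorem hasDerivAt_circlePoint (φ : ℝ) :
    HasDerivAt (fun φ : ℝ => circlePoint φ) (tangentDir φ) φ := by
  simpa only [circlePoint, tangentDir, Angle.cos_coe, Angle.sin_coe] using
    (hasDerivAt_cos φ).prodMk (hasDerivAt_sin φ)

theorem hasDerivAt_tangentDir (φ : ℝ) :
    HasDerivAt (fun φ : ℝ => tangentDir φ) (-circlePoint φ) φ := by
  simpa only [circlePoint, tangentDir, Angle.cos_coe, Angle.sin_coe, Prod.neg_mk] using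
    (hasDerivAt_sin φ).fun_neg.prodMk (hasDerivAt_cos φ)

theorem tangentDir_ne_zero (θ : Angle) : tangentDir θ ≠ 0 := by
  intro h
  have hsin : -θ.sin = 0 := congrArg Prod.fst h
  have hcos : θ.cos = 0 := congrArg Prod.snd h
  have := Angle.cos_sq_add_sin_sq θ
  nlinarith

theorem exists_circlePoint_eq {z : ℝ × ℝ} (hz : z.1 ^ 2 + z.2 ^ 2 = 1) :
    ∃ θ, circlePoint θ = z := by
  have hn : ‖(⟨z.1, z.2⟩ : ℂ)‖ = 1 := by
    rw [Complex.norm_def, Complex.normSq_mk, ← sq, ← sq, hz, sqrt_one]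
  refine ⟨(Complex.arg ⟨z.1, z.2⟩ : ℝ), Prod.ext ?_ ?_⟩
  · simpa [circlePoint, hn] using Complex.norm_mul_cos_arg ⟨z.1, z.2⟩
  · simpa [circlePoint, hn] using Complex.norm_mul_sin_arg ⟨z.1, z.2⟩

theorem circlePoint_injective : Function.Injective circlePoint := by
  intro θ α h
  induction θ using Angle.induction_on with | _ φ
  induction α using Angle.induction_on with | _ ψ
  exact Angle.cos_sin_inj (congrArg Prod.fst h) (congrArg Prod.snd h)

@[simp]
theorem tangentPoint_zero (θ : Angle) : tangentPoint θ 0 = circlePoint θ := by simp [tangentPoint]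

theorem tangentPoint_sq_add_sq (θ : Angle) (r : ℝ) :
    (tangentPoint θ r).1 ^ 2 + (tangentPoint θ r).2 ^ 2 = 1 + r ^ 2 := by
  simp only [tangentPoint, circlePoint, tangentDir, Prod.mk_add_mk, Prod.smul_mk, smul_eq_mul]
  linear_combination (1 + r ^ 2) * Angle.cos_sq_add_sin_sq θ

theorem tangentPoint_left_injective (r : ℝ) : Function.Injective (tangentPoint · r) := by
  intro θ α h
  have h₁ := congrArg Prod.fst h
  have h₂ := congrArg Prod.snd h
  simp only [tangentPoint, circlePoint, tangentDir, Prod.mk_add_mk, Prod.smul_mk, smul_eq_mul]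
    at h₁ h₂
  have hr : 1 + r ^ 2 ≠ 0 := by positivity
  exact circlePoint_injective <| Prod.ext
    (mul_left_cancel₀ hr (by simp only [circlePoint]; linear_combination h₁ + r * h₂))
    (mul_left_cancel₀ hr (by simp only [circlePoint]; linear_combination h₂ - r * h₁))

theorem cos_two_arctan (r : ℝ) : cos (2 * arctan r) = (1 - r ^ 2) / (1 + r ^ 2) := by
  rw [cos_two_mul, cos_sq_arctan]
  field_simp
  ring

theorem sin_two_arctan (r : ℝ) : sin (2 * arctan r) = 2 * r / (1 + r ^ 2) := by
  rw [sin_two_mul, sin_arctan, cos_arctan, mul_assoc, div_mul_div_comm, mul_one,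
    mul_self_sqrt (by positivity), mul_div_assoc]

theorem tangentDir_add_two_arctan (θ : Angle) (r : ℝ) :
    (1 + r ^ 2) • tangentDir (θ + (2 * arctan r : ℝ)) =
      (1 - r ^ 2) • tangentDir θ - (2 * r) • circlePoint θ := by
  simp only [tangentDir, circlePoint, Angle.cos_add, Angle.sin_add, Angle.cos_coe, Angle.sin_coe,
    cos_two_arctan, sin_two_arctan, Prod.smul_mk, Prod.mk_sub_mk, smul_eq_mul]
  ext <;> (field_simp <;> ring)

/-- The other tangent through `tangentPoint θ r` is reached by a turn of `2 arctan r`. -/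
theorem tangentPoint_add_two_arctan (θ : Angle) (r : ℝ) :
    tangentPoint (θ + (2 * arctan r : ℝ)) (-r) = tangentPoint θ r := by
  simp only [tangentPoint, tangentDir, circlePoint, Angle.cos_add, Angle.sin_add, Angle.cos_coe,
    Angle.sin_coe, cos_two_arctan, sin_two_arctan, Prod.smul_mk, Prod.mk_add_mk, smul_eq_mul]
  ext <;> (field_simp; ring)

/-! ### Conics around the unit circle -/

/-- The conic `a x² + 2 b x y + c y² + 2 d x + 2 e y + f = 0`. -/
structure Conic where
  (a b c d e f : ℝ)

namespace Conic

/-- The value at `p` of the equation of the conic. -/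
def eval (q : Conic) (p : ℝ × ℝ) : ℝ :=
  q.a * p.1 ^ 2 + 2 * q.b * p.1 * p.2 + q.c * p.2 ^ 2 + 2 * q.d * p.1 + 2 * q.e * p.2 + q.f

/-- The quadratic form of the terms of degree two. -/
def quadPart (q : Conic) (v : ℝ × ℝ) : ℝ :=
  q.a * v.1 ^ 2 + 2 * q.b * v.1 * v.2 + q.c * v.2 ^ 2

/-- Half of the derivative of `q.eval` at `p` in the direction `v`. -/
def halfDeriv (q : Conic) (p v : ℝ × ℝ) : ℝ :=
  (q.a * p.1 + q.b * p.2 + q.d) * v.1 + (q.b * p.1 + q.c * p.2 + q.e) * v.2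

/-- The reduced discriminant of the restriction of `q.eval` to the tangent of the unit circle
at `θ`. -/
def disc (q : Conic) (θ : Angle) : ℝ :=
  q.halfDeriv (circlePoint θ) (tangentDir θ) ^ 2 -
    q.quadPart (tangentDir θ) * q.eval (circlePoint θ)

/-- The square root of the discriminant; `q.next` preserves `dθ / q.density θ`. -/
def density (q : Conic) (θ : Angle) : ℝ := √(q.disc θ)

/-- The larger of the parameters at which the tangent of the unit circle at `θ` meets the conic. -/
def exitTime (q : Conic) (θ : Angle) : ℝ :=
  (q.density θ - q.halfDeriv (circlePoint θ) (tangentDir θ)) / q.quadPart (tangentDir θ)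

/-- The point in which the counterclockwise tangent ray of the unit circle at `θ` meets the
conic. -/
def exitPoint (q : Conic) (θ : Angle) : ℝ × ℝ := tangentPoint θ (q.exitTime θ)

/-- The Poncelet map of the conic: the angle of the second tangent of the unit circle through
`q.exitPoint θ`. -/
def next (q : Conic) (θ : Angle) : Angle := θ + (2 * arctan (q.exitTime θ) : ℝ)

/-- The conic is an ellipse with the unit circle in its interior. -/
structure Surrounds (q : Conic) : Prop where
  quadPart_pos : ∀ v ≠ 0, 0 < q.quadPart v
  eval_neg : ∀ θ, q.eval (circlePoint θ) < 0

variable (q : Conic)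

theorem eval_add_smul (p v : ℝ × ℝ) (r : ℝ) :
    q.eval (p + r • v) = q.quadPart v * r ^ 2 + 2 * q.halfDeriv p v * r + q.eval p := by
  simp only [eval, quadPart, halfDeriv, Prod.fst_add, Prod.snd_add, Prod.smul_fst, Prod.smul_snd,
    smul_eq_mul]
  ring

theorem halfDeriv_add_smul (p v : ℝ × ℝ) (r : ℝ) :
    q.halfDeriv (p + r • v) v = q.quadPart v * r + q.halfDeriv p v := by
  simp only [quadPart, halfDeriv, Prod.fst_add, Prod.snd_add, Prod.smul_fst, Prod.smul_snd,
    smul_eq_mul]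
  ring

theorem halfDeriv_add_right (p v w : ℝ × ℝ) :
    q.halfDeriv p (v + w) = q.halfDeriv p v + q.halfDeriv p w := by
  simp only [halfDeriv, Prod.fst_add, Prod.snd_add]
  ring

theorem halfDeriv_smul_right (p v : ℝ × ℝ) (r : ℝ) :
    q.halfDeriv p (r • v) = r * q.halfDeriv p v := by
  simp only [halfDeriv, Prod.smul_fst, Prod.smul_snd, smul_eq_mul]
  ring

theorem disc_eq_sq {θ : Angle} {r : ℝ} (hr : q.eval (tangentPoint θ r) = 0) :
    q.disc θ = q.halfDeriv (tangentPoint θ r) (tangentDir θ) ^ 2 := by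
  rw [tangentPoint, eval_add_smul] at hr
  rw [disc, tangentPoint, halfDeriv_add_smul]
  linear_combination -q.quadPart (tangentDir θ) * hr

theorem hasDerivAt_eval {z : ℝ → ℝ × ℝ} {v : ℝ × ℝ} {x : ℝ} (hz : HasDerivAt z v x) :
    HasDerivAt (fun x => q.eval (z x)) (2 * q.halfDeriv (z x) v) x := by
  have h₁ : HasDerivAt (fun x => (z x).1) v.1 x := (hasFDerivAt_fst (p := z x)).comp_hasDerivAt x hz
  have h₂ : HasDerivAt (fun x => (z x).2) v.2 x := (hasFDerivAt_snd (p := z x)).comp_hasDerivAt x hz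
  refine ((((((h₁.pow 2).const_mul q.a).add (((h₁.const_mul (2 * q.b)).mul h₂))).add
    ((h₂.pow 2).const_mul q.c)).add (h₁.const_mul (2 * q.d))).add
    (h₂.const_mul (2 * q.e))).add_const q.f |>.congr_deriv ?_
  simp only [halfDeriv]
  ring

theorem continuous_density : Continuous q.density := by
  have hcos := Angle.continuous_cos
  have hsin := Angle.continuous_sin
  unfold density disc halfDeriv quadPart eval circlePoint tangentDir
  fun_prop

namespace Surrounds

variable {q} (h : q.Surrounds)
include h

theorem quadPart_tangentDir_pos (θ : Angle) : 0 < q.quadPart (tangentDir θ) :=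
  h.quadPart_pos _ (tangentDir_ne_zero θ)

theorem disc_pos (θ : Angle) : 0 < q.disc θ := by
  have := mul_neg_of_pos_of_neg (h.quadPart_tangentDir_pos θ) (h.eval_neg θ)
  unfold disc
  linarith [sq_nonneg (q.halfDeriv (circlePoint θ) (tangentDir θ))]

theorem density_pos (θ : Angle) : 0 < q.density θ := sqrt_pos.2 (h.disc_pos θ)

theorem halfDeriv_exitPoint (θ : Angle) :
    q.halfDeriv (q.exitPoint θ) (tangentDir θ) = q.density θ := by
  rw [exitPoint, tangentPoint, halfDeriv_add_smul, exitTime,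
    mul_div_cancel₀ _ (h.quadPart_tangentDir_pos θ).ne', sub_add_cancel]

theorem eval_exitPoint (θ : Angle) : q.eval (q.exitPoint θ) = 0 := by
  have hQ := h.quadPart_tangentDir_pos θ
  have hderiv := h.halfDeriv_exitPoint θ
  have hdisc : q.density θ ^ 2 = q.disc θ := sq_sqrt (h.disc_pos θ).le
  rw [exitPoint, tangentPoint, halfDeriv_add_smul] at hderiv
  rw [disc, ← hderiv] at hdisc
  rw [exitPoint, tangentPoint, eval_add_smul]
  exact mul_left_cancel₀ hQ.ne' (by linear_combination hdisc)

theorem mul_neg_of_eval_eq_zero {θ : Angle} {r r' : ℝ} (hr : q.eval (tangentPoint θ r) = 0)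
    (hr' : q.eval (tangentPoint θ r') = 0) (hne : r ≠ r') : r * r' < 0 := by
  rw [tangentPoint, eval_add_smul] at hr hr'
  have hQ := h.quadPart_tangentDir_pos θ
  have hsum : q.quadPart (tangentDir θ) * (r + r') +
      2 * q.halfDeriv (circlePoint θ) (tangentDir θ) = 0 :=
    mul_left_cancel₀ (sub_ne_zero.2 hne) (by linear_combination hr - hr')
  have hprod : q.quadPart (tangentDir θ) * (r * r') = q.eval (circlePoint θ) := by
    linear_combination r * hsum - hr
  exact neg_of_mul_neg_right (hprod.trans_lt (h.eval_neg θ)) hQ.le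

theorem eq_of_mul_pos {θ : Angle} {r r' : ℝ} (hr : q.eval (tangentPoint θ r) = 0)
    (hr' : q.eval (tangentPoint θ r') = 0) (hpos : 0 < r * r') : r = r' := by
  by_contra hne
  exact hpos.not_gt (h.mul_neg_of_eval_eq_zero hr hr' hne)

theorem mul_halfDeriv_pos {θ : Angle} {r : ℝ} (hr : q.eval (tangentPoint θ r) = 0) :
    0 < r * q.halfDeriv (tangentPoint θ r) (tangentDir θ) := by
  rw [tangentPoint, eval_add_smul] at hr
  rw [tangentPoint, halfDeriv_add_smul]
  nlinarith [h.eval_neg θ, mul_nonneg (h.quadPart_tangentDir_pos θ).le (sq_nonneg r)]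

theorem exitTime_pos (θ : Angle) : 0 < q.exitTime θ :=
  pos_of_mul_pos_left ((h.mul_halfDeriv_pos (h.eval_exitPoint θ)).trans_eq
    (congrArg _ (h.halfDeriv_exitPoint θ))) (h.density_pos θ).le

omit h in
theorem tangentPoint_next (θ : Angle) :
    tangentPoint (q.next θ) (-q.exitTime θ) = q.exitPoint θ :=
  tangentPoint_add_two_arctan θ _

theorem eval_tangentPoint_next (θ : Angle) :
    q.eval (tangentPoint (q.next θ) (-q.exitTime θ)) = 0 := by
  rw [tangentPoint_next, h.eval_exitPoint]

theorem density_next (θ : Angle) :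
    q.density (q.next θ) = -q.halfDeriv (q.exitPoint θ) (tangentDir (q.next θ)) := by
  have hsign := h.mul_halfDeriv_pos (h.eval_tangentPoint_next θ)
  have hneg := neg_of_mul_pos_right hsign (neg_neg_of_pos (h.exitTime_pos θ)).le
  rw [density, q.disc_eq_sq (h.eval_tangentPoint_next θ), sqrt_sq_eq_abs, abs_of_neg hneg,
    tangentPoint_next]

theorem exitPoint_injective : Function.Injective q.exitPoint := by
  intro θ α heq
  have hsq : 1 + q.exitTime θ ^ 2 = 1 + q.exitTime α ^ 2 := by
    rw [← tangentPoint_sq_add_sq, ← tangentPoint_sq_add_sq, ← exitPoint, ← exitPoint, heq]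
  have htime : q.exitTime θ = q.exitTime α :=
    (sq_eq_sq₀ (h.exitTime_pos θ).le (h.exitTime_pos α).le).1 (add_left_cancel hsq)
  rw [exitPoint, exitPoint, htime] at heq
  exact tangentPoint_left_injective _ heq

theorem next_injective : Function.Injective q.next := by
  intro θ α heq
  have htime : -q.exitTime θ = -q.exitTime α := by
    refine h.eq_of_mul_pos (h.eval_tangentPoint_next θ) ?_ ?_
    · rw [heq, h.eval_tangentPoint_next]
    · exact mul_pos_of_neg_of_neg (neg_neg_of_pos (h.exitTime_pos θ))
        (neg_neg_of_pos (h.exitTime_pos α))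
  apply h.exitPoint_injective
  rw [← tangentPoint_next, ← tangentPoint_next, heq, htime]

theorem differentiable_exitTime : Differentiable ℝ fun φ : ℝ => q.exitTime φ := by
  have hQ : Differentiable ℝ fun φ : ℝ => q.quadPart (tangentDir φ) := by
    simp only [quadPart, tangentDir, Angle.cos_coe, Angle.sin_coe]
    fun_prop
  have hL : Differentiable ℝ fun φ : ℝ => q.halfDeriv (circlePoint φ) (tangentDir φ) := by
    simp only [halfDeriv, circlePoint, tangentDir, Angle.cos_coe, Angle.sin_coe]
    fun_prop
  have hC : Differentiable ℝ fun φ : ℝ => q.eval (circlePoint φ) := by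
    simp only [eval, circlePoint, Angle.cos_coe, Angle.sin_coe]
    fun_prop
  have hdisc : Differentiable ℝ fun φ : ℝ => q.disc φ := (hL.pow 2).sub (hQ.mul hC)
  exact ((hdisc.sqrt fun φ => (h.disc_pos φ).ne').sub hL).div hQ
    fun φ => (h.quadPart_tangentDir_pos φ).ne'

/-- The velocity of the exit point is tangent to the conic, and it is a combination of the
directions of the two tangents of the circle through that point. -/
theorem deriv_exitTime (φ : ℝ) : 2 * deriv (fun φ : ℝ => q.exitTime φ) φ =
    (1 + q.exitTime φ ^ 2) * (q.density (q.next φ) / q.density φ - 1) := by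
  set r := q.exitTime φ
  set r' := deriv (fun φ : ℝ => q.exitTime φ) φ
  have hpoint : HasDerivAt (fun φ : ℝ => q.exitPoint φ) _ φ := (hasDerivAt_circlePoint φ).add
    ((h.differentiable_exitTime φ).hasDerivAt.smul (hasDerivAt_tangentDir φ))
  have hzero : HasDerivAt (fun φ : ℝ => q.eval (q.exitPoint φ)) 0 φ := by
    simp only [h.eval_exitPoint, hasDerivAt_const]
  have hvel : tangentDir φ + (r • -circlePoint φ + r' • tangentDir φ) =
      ((1 + r ^ 2) / 2) • (tangentDir (q.next φ) + tangentDir φ) + r' • tangentDir φ := by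
    have hnext : (1 + r ^ 2) • tangentDir (q.next φ) = _ := tangentDir_add_two_arctan φ r
    rw [div_eq_inv_mul, mul_smul, smul_add (1 + r ^ 2), hnext]
    module
  have hbal : (1 + r ^ 2) / 2 * (q.density φ - q.density (q.next φ)) + r' * q.density φ = 0 := by
    have := (q.hasDerivAt_eval hpoint).unique hzero
    rw [hvel, halfDeriv_add_right, halfDeriv_smul_right, halfDeriv_add_right, halfDeriv_smul_right,
      h.halfDeriv_exitPoint, ← neg_eq_iff_eq_neg.2 (h.density_next φ)] at this
    linarith
  have := (h.density_pos φ).ne'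
  field_simp
  linear_combination 2 * hbal

theorem preservesDensity_next : PreservesDensity q.density q.next := by
  refine ⟨fun φ => φ + 2 * arctan (q.exitTime φ), fun φ => ⟨by simp only [Angle.coe_add, next], ?_⟩⟩
  refine ((hasDerivAt_id φ).add
    ((h.differentiable_exitTime φ).hasDerivAt.arctan.const_mul 2)).congr_deriv ?_
  rw [div_mul_eq_mul_div, one_mul, mul_div_assoc', h.deriv_exitTime φ,
    mul_div_cancel_left₀ _ (by positivity), add_sub_cancel]

end Surrounds

end Conic

/-! ### Inscribed polygonal lines -/

theorem iterate_of_adjacent {α : Type*} {f : α → α} (hf : Function.Injective f) {u : ℕ → α}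
    (hadj : ∀ i, u (i + 1) = f (u i) ∨ u i = f (u (i + 1))) (hne : ∀ i, u (i + 2) ≠ u i) :
    (∀ i n, u (i + n) = f^[n] (u i)) ∨ ∀ i n, u i = f^[n] (u (i + n)) := by
  rcases hadj 0 with h₀ | h₀
  · left
    have hstep (i : ℕ) : u (i + 1) = f (u i) := by
      induction i with
      | zero => exact h₀
      | succ i ih => exact (hadj (i + 1)).resolve_right fun h => hne i (hf (h.symm.trans ih))
    intro i n
    induction n with
    | zero => rfl
    | succ n ih => rw [Function.iterate_succ_apply', ← ih, ← hstep, add_assoc]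
  · right
    have hstep (i : ℕ) : u i = f (u (i + 1)) := by
      induction i with
      | zero => exact h₀
      | succ i ih => exact (hadj (i + 1)).resolve_left fun h => hne i (h.trans ih.symm)
    intro i n
    induction n with
    | zero => rfl
    | succ n ih => rw [Function.iterate_succ_apply, ← add_assoc, ← hstep, ← ih]

namespace Conic

/-- The points `z 0, z 1, z 2, …` are the successive vertices of a polygonal line inscribed in the
conic and circumscribed about the unit circle. -/
structure IsPonceletLine (q : Conic) (z : ℕ → ℝ × ℝ) : Prop where
  eval_eq_zero : ∀ i, q.eval (z i) = 0
  succ_ne : ∀ i, z (i + 1) ≠ z i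
  exists_tangent : ∀ i, ∃ θ r r', z i = tangentPoint θ r ∧ z (i + 1) = tangentPoint θ r'
  add_two_ne : ∀ i, z (i + 2) ≠ z i

variable {q : Conic}

namespace Surrounds

variable (h : q.Surrounds)
include h

theorem exitPoint_eq_of_pos {θ : Angle} {r : ℝ} (hr : q.eval (tangentPoint θ r) = 0)
    (hpos : 0 < r) : q.exitPoint θ = tangentPoint θ r := by
  rw [exitPoint, h.eq_of_mul_pos (h.eval_exitPoint θ) hr (mul_pos (h.exitTime_pos θ) hpos)]

theorem exists_exitPoint_eq_of_neg {θ : Angle} {r : ℝ} (hr : q.eval (tangentPoint θ r) = 0)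
    (hneg : r < 0) : ∃ α, q.next α = θ ∧ q.exitPoint α = tangentPoint θ r := by
  let α := θ + (2 * arctan r : ℝ)
  have hα : tangentPoint α (-r) = tangentPoint θ r := tangentPoint_add_two_arctan θ r
  have htime : q.exitTime α = -r := h.eq_of_mul_pos (h.eval_exitPoint α) (by rwa [hα])
    (mul_pos (h.exitTime_pos α) (neg_pos.2 hneg))
  refine ⟨α, ?_, by rw [exitPoint, htime, hα]⟩
  rw [next, htime, arctan_neg, add_assoc, ← Angle.coe_add, mul_neg, add_neg_cancel, Angle.coe_zero,
    add_zero]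

theorem exists_exitPoint_eq {θ : Angle} {r : ℝ} (hr : q.eval (tangentPoint θ r) = 0) :
    ∃ α, q.exitPoint α = tangentPoint θ r := by
  rcases lt_trichotomy r 0 with hneg | rfl | hpos
  · exact (h.exists_exitPoint_eq_of_neg hr hneg).imp fun _ => And.right
  · exact absurd hr (by rw [tangentPoint_zero]; exact (h.eval_neg θ).ne)
  · exact ⟨θ, h.exitPoint_eq_of_pos hr hpos⟩

theorem eq_next_of_neg_of_pos {θ α β : Angle} {r r' : ℝ} (hα : q.exitPoint α = tangentPoint θ r)
    (hβ : q.exitPoint β = tangentPoint θ r') (hr : r < 0) (hr' : 0 < r') : β = q.next α := by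
  obtain ⟨α', hnext, hα'⟩ :=
    h.exists_exitPoint_eq_of_neg (by rw [← hα, h.eval_exitPoint]) hr
  have hαα' : α = α' := h.exitPoint_injective (hα.trans hα'.symm)
  have hβθ : β = θ := h.exitPoint_injective <|
    hβ.trans (h.exitPoint_eq_of_pos (by rw [← hβ, h.eval_exitPoint]) hr').symm
  rw [hβθ, hαα', hnext]

theorem eq_next_or_eq_next {θ α β : Angle} {r r' : ℝ} (hα : q.exitPoint α = tangentPoint θ r)
    (hβ : q.exitPoint β = tangentPoint θ r') (hne : r ≠ r') : β = q.next α ∨ α = q.next β := by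
  have hneg := h.mul_neg_of_eval_eq_zero (θ := θ) (by rw [← hα, h.eval_exitPoint])
    (by rw [← hβ, h.eval_exitPoint]) hne
  rcases mul_neg_iff.1 hneg with ⟨hr, hr'⟩ | ⟨hr, hr'⟩
  · exact .inr (h.eq_next_of_neg_of_pos hβ hα hr' hr)
  · exact .inl (h.eq_next_of_neg_of_pos hα hβ hr hr')

theorem exists_angles {z : ℕ → ℝ × ℝ} (hz : q.IsPonceletLine z) :
    ∃ α : ℕ → Angle, (∀ i, q.exitPoint (α i) = z i) ∧
      ((∀ i n, α (i + n) = q.next^[n] (α i)) ∨ ∀ i n, α i = q.next^[n] (α (i + n))) := by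
  choose θ r r' hr hr' using hz.exists_tangent
  have hexit (i : ℕ) : ∃ α, q.exitPoint α = z i := by
    rw [hr i]
    exact h.exists_exitPoint_eq (by rw [← hr i, hz.eval_eq_zero])
  choose α hα using hexit
  refine ⟨α, hα, iterate_of_adjacent h.next_injective (fun i => ?_) fun i heq => ?_⟩
  · refine h.eq_next_or_eq_next ((hα i).trans (hr i)) ((hα (i + 1)).trans (hr' i)) fun heq => ?_
    exact hz.succ_ne i (by rw [hr' i, ← heq, ← hr i])
  · exact hz.add_two_ne i (by rw [← hα, heq, hα])

theorem iterate_next_eq_self {z : ℕ → ℝ × ℝ} (hz : q.IsPonceletLine z) {n : ℕ} (hn : z n = z 0)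
    (θ : Angle) : q.next^[n] θ = θ := by
  obtain ⟨α, hα, hiter⟩ := h.exists_angles hz
  have hαn : α (0 + n) = α 0 := h.exitPoint_injective (by rw [zero_add, hα, hα, hn])
  have hfix : q.next^[n] (α 0) = α 0 := by
    rcases hiter with hiter | hiter
    · rw [← hiter, hαn]
    · nth_rw 1 [← hαn]; rw [← hiter]
  exact (h.preservesDensity_next.iterate h.density_pos n).eq_self_of_isFixedPt
    q.continuous_density h.density_pos hfix θ

theorem periodic {z y : ℕ → ℝ × ℝ} (hz : q.IsPonceletLine z) (hy : q.IsPonceletLine y) {n : ℕ}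
    (hn : z n = z 0) : Function.Periodic y n := by
  obtain ⟨α, hα, hiter⟩ := h.exists_angles hy
  have hid := h.iterate_next_eq_self hz hn
  intro i
  rw [← hα, ← hα]
  rcases hiter with hiter | hiter
  · rw [hiter, hid]
  · rw [hiter i n, hid]

end Surrounds

end Conic

/-! ### Affine charts that straighten an ellipse -/

/-- The affine chart `Φ` of the plane takes the unit circle to `E`. -/
def IsUnitChart (Φ : (ℝ × ℝ) ≃ᵃ[ℝ] Plane) (E : Set Plane) : Prop :=
  ∀ z, Φ z ∈ E ↔ z.1 ^ 2 + z.2 ^ 2 = 1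

/-- The image under the chart `Φ` of the tangent of the unit circle at `θ`. -/
def chartTangent (Φ : (ℝ × ℝ) ≃ᵃ[ℝ] Plane) (θ : Angle) : AffineSubspace ℝ Plane :=
  AffineSubspace.mk' (Φ (circlePoint θ)) (Submodule.span ℝ {Φ.linear (tangentDir θ)})

theorem mem_mk'_span {V : Type*} [AddCommGroup V] [Module ℝ V] {p v x : V} :
    x ∈ AffineSubspace.mk' p (Submodule.span ℝ {v}) ↔ ∃ r : ℝ, x = p + r • v := by
  simp only [AffineSubspace.mem_mk', vsub_eq_sub, Submodule.mem_span_singleton,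
    eq_sub_iff_add_eq', eq_comm (a := x)]

theorem exists_eq_mk'_span {V : Type*} [AddCommGroup V] [Module ℝ V] {L : AffineSubspace ℝ V}
    (hL : Module.finrank ℝ L.direction = 1) {y : V} (hy : y ∈ L) :
    ∃ v ≠ 0, L = AffineSubspace.mk' y (Submodule.span ℝ {v}) := by
  have := Module.finite_of_finrank_eq_succ hL
  obtain ⟨v, hv, hv0⟩ :=
    Submodule.exists_mem_ne_zero_of_ne_bot (Submodule.one_le_finrank_iff.1 hL.ge)
  refine ⟨v, hv0, ?_⟩
  rw [Submodule.eq_of_le_of_finrank_eq ((Submodule.span_singleton_le_iff_mem v _).2 hv)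
    (by rw [finrank_span_singleton hv0, hL]), AffineSubspace.mk'_eq hy]

theorem affineEquiv_add_smul {V W : Type*} [AddCommGroup V] [Module ℝ V] [AddCommGroup W]
    [Module ℝ W] (Φ : V ≃ᵃ[ℝ] W) (z v : V) (r : ℝ) :
    Φ (z + r • v) = Φ z + r • Φ.linear v := by
  rw [add_comm z, ← vadd_eq_add, Φ.map_vadd, map_smul, vadd_eq_add, add_comm]

theorem sq_add_sq_pos {w : ℝ × ℝ} (hw : w ≠ 0) : 0 < w.1 ^ 2 + w.2 ^ 2 := by
  contrapose! hw
  exact Prod.ext (by rw [Prod.fst_zero]; nlinarith [sq_nonneg w.1, sq_nonneg w.2])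
    (by rw [Prod.snd_zero]; nlinarith [sq_nonneg w.1, sq_nonneg w.2])

theorem exists_eq_smul_tangentDir {θ : Angle} {w : ℝ × ℝ}
    (hperp : θ.cos * w.1 + θ.sin * w.2 = 0) : ∃ k : ℝ, w = k • tangentDir θ := by
  have hθ := θ.cos_sq_add_sin_sq
  refine ⟨θ.cos * w.2 - θ.sin * w.1, Prod.ext ?_ ?_⟩ <;>
    simp only [tangentDir, Prod.smul_mk, smul_eq_mul]
  · linear_combination -w.1 * hθ + θ.cos * hperp
  · linear_combination -w.2 * hθ + θ.sin * hperp

theorem perp_of_forall_eq_zero {θ : Angle} {w : ℝ × ℝ} (hw : w ≠ 0)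
    (h : ∀ r : ℝ, (circlePoint θ + r • w).1 ^ 2 + (circlePoint θ + r • w).2 ^ 2 = 1 → r = 0) :
    θ.cos * w.1 + θ.sin * w.2 = 0 := by
  have hw' := sq_add_sq_pos hw
  set r := -2 * (θ.cos * w.1 + θ.sin * w.2) / (w.1 ^ 2 + w.2 ^ 2)
  have hrw : r * (w.1 ^ 2 + w.2 ^ 2) = -2 * (θ.cos * w.1 + θ.sin * w.2) :=
    div_mul_cancel₀ _ hw'.ne'
  have hr0 : r = 0 := h r <| by
    simp only [circlePoint, Prod.fst_add, Prod.snd_add, Prod.smul_fst, Prod.smul_snd, smul_eq_mul]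
    linear_combination θ.cos_sq_add_sin_sq + r * hrw
  rw [hr0, zero_mul] at hrw
  linarith

section

variable {Φ : (ℝ × ℝ) ≃ᵃ[ℝ] Plane} {θ : Angle} {E : Set Plane}

theorem mem_chartTangent {x : Plane} : x ∈ chartTangent Φ θ ↔ ∃ r, x = Φ (tangentPoint θ r) := by
  simp only [chartTangent, mem_mk'_span, tangentPoint, affineEquiv_add_smul]

theorem mk'_span_eq_chartTangent_iff {z w : ℝ × ℝ} (hw : w ≠ 0) :
    AffineSubspace.mk' (Φ z) (Submodule.span ℝ {Φ.linear w}) = chartTangent Φ θ ↔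
      (∃ r, z = tangentPoint θ r) ∧ ∃ k : ℝ, w = k • tangentDir θ := by
  constructor
  · intro h
    constructor
    · obtain ⟨r, hr⟩ := mem_chartTangent.1 (h ▸ AffineSubspace.self_mem_mk' _ _)
      exact ⟨r, Φ.injective hr⟩
    · have hdir := congrArg AffineSubspace.direction h
      rw [chartTangent, AffineSubspace.direction_mk', AffineSubspace.direction_mk'] at hdir
      obtain ⟨k, hk⟩ := Submodule.mem_span_singleton.1
        (hdir ▸ Submodule.mem_span_singleton_self (Φ.linear w))
      exact ⟨k, Φ.linear.injective (by rw [map_smul, hk])⟩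
  · rintro ⟨⟨r, rfl⟩, k, rfl⟩
    have hk : k ≠ 0 := (smul_ne_zero_iff.1 hw).1
    rw [map_smul, Submodule.span_singleton_smul_eq (IsUnit.mk0 k hk),
      ← AffineSubspace.mk'_eq (mem_chartTangent.2 ⟨r, rfl⟩), chartTangent,
      AffineSubspace.direction_mk']

theorem isTangentAt_chartTangent (hΦ : IsUnitChart Φ E) (θ : Angle) :
    IsTangentAt E (chartTangent Φ θ) (Φ (circlePoint θ)) := by
  constructor
  · rw [chartTangent, AffineSubspace.direction_mk']
    exact finrank_span_singleton
      ((map_ne_zero_iff _ Φ.linear.injective).2 (tangentDir_ne_zero θ))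
  · ext x
    simp only [Set.mem_inter_iff, SetLike.mem_coe, Set.mem_singleton_iff, mem_chartTangent]
    constructor
    · rintro ⟨⟨r, rfl⟩, h⟩
      rw [hΦ, tangentPoint_sq_add_sq, add_eq_left, sq_eq_zero_iff] at h
      rw [h, tangentPoint_zero]
    · rintro rfl
      exact ⟨⟨0, by rw [tangentPoint_zero]⟩, (hΦ _).2 θ.cos_sq_add_sin_sq⟩

theorem IsTangentAt.exists_angle (hΦ : IsUnitChart Φ E) {L : AffineSubspace ℝ Plane} {y : Plane}
    (h : IsTangentAt E L y) : ∃ θ, y = Φ (circlePoint θ) ∧ L = chartTangent Φ θ := by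
  obtain ⟨hfin, hL⟩ := h
  have hy : y ∈ (L : Set Plane) ∩ E := by rw [hL]; rfl
  obtain ⟨v, hv, rfl⟩ := exists_eq_mk'_span hfin hy.1
  obtain ⟨z, rfl⟩ := Φ.surjective y
  obtain ⟨w, rfl⟩ := Φ.linear.surjective v
  obtain ⟨θ, rfl⟩ := exists_circlePoint_eq ((hΦ z).1 hy.2)
  have hw : w ≠ 0 := (map_ne_zero_iff _ Φ.linear.injective).1 hv
  have hperp : θ.cos * w.1 + θ.sin * w.2 = 0 := perp_of_forall_eq_zero hw fun r hr => by
    have hmem : Φ (circlePoint θ + r • w) ∈ ({Φ (circlePoint θ)} : Set Plane) :=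
      hL ▸ ⟨mem_mk'_span.2 ⟨r, affineEquiv_add_smul Φ _ _ _⟩, (hΦ _).2 hr⟩
    simpa [hw] using Φ.injective hmem
  exact ⟨θ, rfl, (mk'_span_eq_chartTangent_iff hw).2
    ⟨⟨0, (tangentPoint_zero θ).symm⟩, exists_eq_smul_tangentDir hperp⟩⟩

theorem isTangent_iff_exists_angle (hΦ : IsUnitChart Φ E) {L : AffineSubspace ℝ Plane} :
    IsTangent E L ↔ ∃ θ, L = chartTangent Φ θ := by
  constructor
  · rintro ⟨_, hy⟩
    exact (hy.exists_angle hΦ).imp fun _ => And.right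
  · rintro ⟨θ, rfl⟩
    exact ⟨_, isTangentAt_chartTangent hΦ θ⟩

/-- The tangents of the unit circle are the lines at distance `1` from its centre. -/
theorem isTangent_mk'_span_iff (hΦ : IsUnitChart Φ E) (z : ℝ × ℝ) {w : ℝ × ℝ} (hw : w ≠ 0) :
    IsTangent E (AffineSubspace.mk' (Φ z) (Submodule.span ℝ {Φ.linear w})) ↔
      w.1 ^ 2 + w.2 ^ 2 = (z.1 * w.2 - z.2 * w.1) ^ 2 := by
  rw [isTangent_iff_exists_angle hΦ]
  simp only [mk'_span_eq_chartTangent_iff hw]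
  constructor
  · rintro ⟨θ, ⟨r, rfl⟩, k, rfl⟩
    simp only [tangentPoint, circlePoint, tangentDir, Prod.smul_mk, Prod.mk_add_mk, smul_eq_mul]
    linear_combination -k ^ 2 * (θ.cos ^ 2 + θ.sin ^ 2) * θ.cos_sq_add_sin_sq
  · intro h
    have hw' := (sq_add_sq_pos hw).ne'
    let r := -(z.1 * w.1 + z.2 * w.2) / (w.1 ^ 2 + w.2 ^ 2)
    have hr : r * (w.1 ^ 2 + w.2 ^ 2) = -(z.1 * w.1 + z.2 * w.2) := div_mul_cancel₀ _ hw'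
    obtain ⟨θ, hθ⟩ : ∃ θ, circlePoint θ = z + r • w := exists_circlePoint_eq <| by
      simp only [Prod.fst_add, Prod.snd_add, Prod.smul_fst, Prod.smul_snd, smul_eq_mul]
      apply mul_left_cancel₀ hw'
      linear_combination (r * (w.1 ^ 2 + w.2 ^ 2) + (z.1 * w.1 + z.2 * w.2)) * hr - h
    obtain ⟨k, hk⟩ : ∃ k : ℝ, w = k • tangentDir θ := exists_eq_smul_tangentDir <| by
      have hcos : θ.cos = z.1 + r * w.1 := congrArg Prod.fst hθ
      have hsin : θ.sin = z.2 + r * w.2 := congrArg Prod.snd hθ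
      rw [hcos, hsin]
      linear_combination hr
    refine ⟨θ, ⟨-r * k, ?_⟩, k, hk⟩
    rw [tangentPoint, mul_smul, ← hk, hθ, neg_smul, add_neg_cancel_right]

end

/-! ### The porism in charts -/

/-- The equation `x² + y² = 1` pulled back by an affine map. -/
def pullbackConic (A : (ℝ × ℝ) ≃ᵃ[ℝ] (ℝ × ℝ)) : Conic where
  a := (A.linear (1, 0)).1 ^ 2 + (A.linear (1, 0)).2 ^ 2
  b := (A.linear (1, 0)).1 * (A.linear (0, 1)).1 + (A.linear (1, 0)).2 * (A.linear (0, 1)).2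
  c := (A.linear (0, 1)).1 ^ 2 + (A.linear (0, 1)).2 ^ 2
  d := (A 0).1 * (A.linear (1, 0)).1 + (A 0).2 * (A.linear (1, 0)).2
  e := (A 0).1 * (A.linear (0, 1)).1 + (A 0).2 * (A.linear (0, 1)).2
  f := (A 0).1 ^ 2 + (A 0).2 ^ 2 - 1

section

variable (A : (ℝ × ℝ) ≃ᵃ[ℝ] (ℝ × ℝ))

theorem linear_apply_eq (z : ℝ × ℝ) :
    A.linear z = z.1 • A.linear (1, 0) + z.2 • A.linear (0, 1) := by
  rw [← map_smul, ← map_smul, ← map_add]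
  simp

theorem eval_pullbackConic (z : ℝ × ℝ) :
    (pullbackConic A).eval z = (A z).1 ^ 2 + (A z).2 ^ 2 - 1 := by
  have hA : A z = A.linear z + A 0 := by simpa using A.map_vadd 0 z
  rw [hA, linear_apply_eq]
  simp only [pullbackConic, Conic.eval, Prod.fst_add, Prod.snd_add, Prod.smul_fst, Prod.smul_snd,
    smul_eq_mul]
  ring

theorem quadPart_pullbackConic (v : ℝ × ℝ) :
    (pullbackConic A).quadPart v = (A.linear v).1 ^ 2 + (A.linear v).2 ^ 2 := by
  rw [linear_apply_eq]
  simp only [pullbackConic, Conic.quadPart, Prod.fst_add, Prod.snd_add, Prod.smul_fst,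
    Prod.smul_snd, smul_eq_mul]
  ring

variable {A}

theorem surrounds_pullbackConic
    (h : ∀ θ, (A (circlePoint θ)).1 ^ 2 + (A (circlePoint θ)).2 ^ 2 < 1) :
    (pullbackConic A).Surrounds where
  quadPart_pos v hv := by
    rw [quadPart_pullbackConic]
    exact sq_add_sq_pos ((map_ne_zero_iff _ A.linear.injective).2 hv)
  eval_neg θ := by
    rw [eval_pullbackConic]
    exact sub_neg_of_lt (h θ)

end

section

variable {Φ Ψ : (ℝ × ℝ) ≃ᵃ[ℝ] Plane} {E C : Set Plane}

theorem IsPonceletLine.of_chart (hΦ : IsUnitChart Φ C) {q : Conic}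
    (hq : ∀ z, Φ z ∈ E ↔ q.eval z = 0) {x : ℕ → Plane} (hx : IsPonceletLine E C x) :
    q.IsPonceletLine fun i => Φ.symm (x i) where
  eval_eq_zero i := by rw [← hq, Φ.apply_symm_apply]; exact hx.1 i
  succ_ne i := Φ.symm.injective.ne (hx.2.1 i)
  exists_tangent i := by
    obtain ⟨θ, hθ⟩ := (isTangent_iff_exists_angle hΦ).1 (hx.2.2.1 i)
    obtain ⟨r, hr⟩ := mem_chartTangent.1 (hθ ▸ AffineSubspace.self_mem_mk' _ _)
    obtain ⟨r', hr'⟩ := mem_chartTangent.1 (hθ ▸ mem_mk'_span.2 ⟨1, by rw [one_smul]; abel⟩ :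
      x (i + 1) ∈ chartTangent Φ θ)
    exact ⟨θ, r, r', by rw [hr, Φ.symm_apply_apply], by rw [hr', Φ.symm_apply_apply]⟩
  add_two_ne i := Φ.symm.injective.ne (hx.2.2.2 i)

theorem IsPonceletLine.periodic_of_chart (hΦ : IsUnitChart Φ C) (hΨ : IsUnitChart Ψ E)
    (hin : ∀ θ, (Ψ.symm (Φ (circlePoint θ))).1 ^ 2 + (Ψ.symm (Φ (circlePoint θ))).2 ^ 2 < 1)
    {x y : ℕ → Plane} (hx : IsPonceletLine E C x) (hy : IsPonceletLine E C y) {n : ℕ}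
    (hn : x n = x 0) : Function.Periodic y n := by
  have hsurrounds : (pullbackConic (Φ.trans Ψ.symm)).Surrounds := surrounds_pullbackConic hin
  have hq (z : ℝ × ℝ) : Φ z ∈ E ↔ (pullbackConic (Φ.trans Ψ.symm)).eval z = 0 := by
    rw [eval_pullbackConic, sub_eq_zero, AffineEquiv.trans_apply, ← hΨ, Ψ.apply_symm_apply]
  have := hsurrounds.periodic (hx.of_chart hΦ hq) (hy.of_chart hΦ hq) (congrArg Φ.symm hn)
  exact fun i => Φ.symm.injective (this i)

end

/-! ### Ellipses with given foci -/

/-- The plane in the orthonormal coordinates whose axes are turned by `ω`. -/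
def rotLin (ω : Angle) : (ℝ × ℝ) ≃ₗ[ℝ] Plane where
  toFun z := !₂[z.1 * ω.cos - z.2 * ω.sin, z.1 * ω.sin + z.2 * ω.cos]
  invFun p := (p 0 * ω.cos + p 1 * ω.sin, p 1 * ω.cos - p 0 * ω.sin)
  map_add' z w := by ext i; fin_cases i <;> simp <;> ring
  map_smul' r z := by ext i; fin_cases i <;> simp <;> ring
  left_inv z := Prod.ext
    (by simp only [Matrix.cons_val_zero, Matrix.cons_val_one]
        linear_combination z.1 * ω.cos_sq_add_sin_sq)
    (by simp only [Matrix.cons_val_zero, Matrix.cons_val_one]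
        linear_combination z.2 * ω.cos_sq_add_sin_sq)
  right_inv p := by
    ext i
    fin_cases i
    · change (p 0 * ω.cos + p 1 * ω.sin) * ω.cos - (p 1 * ω.cos - p 0 * ω.sin) * ω.sin = p 0
      linear_combination p 0 * ω.cos_sq_add_sin_sq
    · change (p 0 * ω.cos + p 1 * ω.sin) * ω.sin + (p 1 * ω.cos - p 0 * ω.sin) * ω.cos = p 1
      linear_combination p 1 * ω.cos_sq_add_sin_sq

theorem rotLin_apply (ω : Angle) (z : ℝ × ℝ) :
    rotLin ω z = !₂[z.1 * ω.cos - z.2 * ω.sin, z.1 * ω.sin + z.2 * ω.cos] := rfl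

theorem inner_rotLin (ω : Angle) (z w : ℝ × ℝ) :
    inner ℝ (rotLin ω z) (rotLin ω w) = z.1 * w.1 + z.2 * w.2 := by
  simp only [rotLin_apply, PiLp.inner_apply, Fin.sum_univ_two,
    Matrix.cons_val_zero, Matrix.cons_val_one, RCLike.inner_apply, conj_trivial]
  linear_combination (z.1 * w.1 + z.2 * w.2) * ω.cos_sq_add_sin_sq

theorem norm_rotLin (ω : Angle) (z : ℝ × ℝ) : ‖rotLin ω z‖ = √(z.1 ^ 2 + z.2 ^ 2) := by
  rw [norm_eq_sqrt_real_inner, inner_rotLin, sq, sq]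

theorem dist_rotLin_add (ω : Angle) (z w : ℝ × ℝ) (C : Plane) :
    dist (rotLin ω z + C) (rotLin ω w + C) = √((z.1 - w.1) ^ 2 + (z.2 - w.2) ^ 2) := by
  rw [dist_add_right, dist_eq_norm, ← map_sub, norm_rotLin, Prod.fst_sub, Prod.snd_sub]

theorem exists_rotLin_eq (p : Plane) : ∃ ω r, 0 ≤ r ∧ rotLin ω (r, 0) = p := by
  refine ⟨(Complex.arg ⟨p 0, p 1⟩ : ℝ), ‖(⟨p 0, p 1⟩ : ℂ)‖, norm_nonneg _, ?_⟩
  ext i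
  fin_cases i
  · simp [rotLin_apply, Complex.norm_mul_cos_arg]
  · simp [rotLin_apply, Complex.norm_mul_sin_arg]

/-- The chart with centre `C`, axes turned by `ω` and semi-axes `a`, `b`. A negative semi-axis
reverses the orientation of the chart. -/
def frame (C : Plane) (ω : Angle) {a b : ℝ} (ha : a ≠ 0) (hb : b ≠ 0) : (ℝ × ℝ) ≃ᵃ[ℝ] Plane :=
  (((LinearEquiv.smulOfNeZero ℝ ℝ a ha).prodCongr (LinearEquiv.smulOfNeZero ℝ ℝ b hb)).trans
    (rotLin ω)).toAffineEquiv.trans (AffineEquiv.vaddConst ℝ C)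

theorem frame_apply (C : Plane) (ω : Angle) {a b : ℝ} (ha : a ≠ 0) (hb : b ≠ 0) (z : ℝ × ℝ) :
    frame C ω ha hb z = rotLin ω (a * z.1, b * z.2) + C := rfl

theorem frame_linear_apply (C : Plane) (ω : Angle) {a b : ℝ} (ha : a ≠ 0) (hb : b ≠ 0)
    (z : ℝ × ℝ) : (frame C ω ha hb).linear z = rotLin ω (a * z.1, b * z.2) := rfl

/-- Orthonormal coordinates with origin `C` and axes turned by `ω` in which the foci are
`(-c, 0)` and `(c, 0)`. -/
structure FocalFrame (F₁ F₂ C : Plane) (ω : Angle) (c : ℝ) : Prop where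
  nonneg : 0 ≤ c
  left : F₁ = rotLin ω (-c, 0) + C
  right : F₂ = rotLin ω (c, 0) + C

/-- `a` and `b` are the semi-axes of the ellipse with half focal distance `c` and distance sum `s`.
The sign of `b` is left open. -/
structure HasSemiAxes (c s a b : ℝ) : Prop where
  lt : c < a
  two_mul : 2 * a = s
  sq_eq : b ^ 2 = a ^ 2 - c ^ 2

theorem exists_focalFrame (F₁ F₂ : Plane) : ∃ C ω c, FocalFrame F₁ F₂ C ω c := by
  obtain ⟨ω, r, hr, h⟩ := exists_rotLin_eq ((2 : ℝ)⁻¹ • (F₂ - F₁))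
  refine ⟨(2 : ℝ)⁻¹ • (F₂ + F₁), ω, r, hr, ?_, ?_⟩
  · rw [show ((-r, 0) : ℝ × ℝ) = -(r, 0) by simp, map_neg, h]
    module
  · rw [h]
    module

theorem exists_hasSemiAxes {c s : ℝ} (hc : 0 ≤ c) (hs : 2 * c < s) :
    ∃ a b, 0 < b ∧ HasSemiAxes c s a b := by
  have hpos : 0 < (s / 2) ^ 2 - c ^ 2 := by nlinarith
  exact ⟨s / 2, √((s / 2) ^ 2 - c ^ 2), sqrt_pos.2 hpos, by linarith, by ring, sq_sqrt hpos.le⟩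

namespace HasSemiAxes

variable {c s a b : ℝ}

theorem neg (h : HasSemiAxes c s a b) : HasSemiAxes c s a (-b) :=
  ⟨h.lt, h.two_mul, by rw [neg_sq, h.sq_eq]⟩

theorem pos (hc : 0 ≤ c) (h : HasSemiAxes c s a b) : 0 < a := hc.trans_lt h.lt

theorem ne_zero (hc : 0 ≤ c) (h : HasSemiAxes c s a b) : b ≠ 0 := by
  have := h.sq_eq
  have := h.lt
  rintro rfl
  nlinarith

end HasSemiAxes

/-- With `d₁`, `d₂` the distances from `(a x, b y)` to the foci, the sign of `d₁ + d₂ - 2 a` is that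
of `x² + y² - 1`. -/
theorem focal_sum_identity {d₁ d₂ c a b x y : ℝ} (h₁ : d₁ ^ 2 = (a * x + c) ^ 2 + (b * y) ^ 2)
    (h₂ : d₂ ^ 2 = (a * x - c) ^ 2 + (b * y) ^ 2) (hb : b ^ 2 = a ^ 2 - c ^ 2) :
    (d₁ + d₂ - 2 * a) * ((d₁ + d₂ + 2 * a) * ((2 * a) ^ 2 - (d₁ - d₂) ^ 2)) =
      16 * (a ^ 2 * b ^ 2) * (x ^ 2 + y ^ 2 - 1) := by
  have hdiff : d₁ ^ 2 - d₂ ^ 2 = 4 * a * c * x := by linear_combination h₁ - h₂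
  linear_combination (-(d₁ ^ 2 - d₂ ^ 2) - 4 * a * c * x) * hdiff + 8 * a ^ 2 * (h₁ + h₂) +
    (16 * a ^ 2 - 16 * a ^ 2 * x ^ 2) * hb

namespace FocalFrame

variable {F₁ F₂ C : Plane} {ω : Angle} {c : ℝ} (h : FocalFrame F₁ F₂ C ω c)
include h

theorem dist_eq : dist F₁ F₂ = 2 * c := by
  rw [h.left, h.right, dist_rotLin_add, sub_self, zero_pow two_ne_zero, add_zero, sqrt_sq_eq_abs,
    ← neg_add', abs_neg, ← two_mul, abs_of_nonneg (by linarith [h.nonneg])]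

theorem sq_dist_sub_dist_le (p : Plane) : (dist p F₁ - dist p F₂) ^ 2 ≤ (2 * c) ^ 2 := by
  rw [← h.dist_eq, sq_le_sq, abs_of_nonneg (dist_nonneg (x := F₁)), dist_comm p, dist_comm p]
  exact abs_dist_sub_le F₁ F₂ p

variable {s a b : ℝ} (hab : HasSemiAxes c s a b) (ha : a ≠ 0) (hb : b ≠ 0)
include hab

theorem exists_pos_mul_eq (z : ℝ × ℝ) : ∃ k, 0 < k ∧
    (dist (frame C ω ha hb z) F₁ + dist (frame C ω ha hb z) F₂ - s) * k =
      z.1 ^ 2 + z.2 ^ 2 - 1 := by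
  set d₁ := dist (frame C ω ha hb z) F₁ with hd₁
  set d₂ := dist (frame C ω ha hb z) F₂ with hd₂
  have h₁ : d₁ ^ 2 = (a * z.1 + c) ^ 2 + (b * z.2) ^ 2 := by
    rw [hd₁, h.left, frame_apply, dist_rotLin_add, sq_sqrt (by positivity), sub_neg_eq_add,
      sub_zero]
  have h₂ : d₂ ^ 2 = (a * z.1 - c) ^ 2 + (b * z.2) ^ 2 := by
    rw [hd₂, h.right, frame_apply, dist_rotLin_add, sq_sqrt (by positivity), sub_zero]
  have ha' := hab.pos h.nonneg
  have hdiff : 0 < (2 * a) ^ 2 - (d₁ - d₂) ^ 2 := by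
    nlinarith [h.sq_dist_sub_dist_le (frame C ω ha hb z), hab.lt, h.nonneg]
  have hden : 0 < 16 * (a ^ 2 * b ^ 2) := by positivity
  refine ⟨(d₁ + d₂ + 2 * a) * ((2 * a) ^ 2 - (d₁ - d₂) ^ 2) / (16 * (a ^ 2 * b ^ 2)),
    by positivity, ?_⟩
  rw [mul_div_assoc', div_eq_iff hden.ne', ← hab.two_mul, focal_sum_identity h₁ h₂ hab.sq_eq,
    mul_comm]

theorem isUnitChart : IsUnitChart (frame C ω ha hb) (ellipse F₁ F₂ s) := by
  intro z
  obtain ⟨k, hk, heq⟩ := h.exists_pos_mul_eq hab ha hb z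
  rw [ellipse, Set.mem_ofPred_eq, ← sub_eq_zero, ← sub_eq_zero (b := (1 : ℝ)), ← heq,
    mul_eq_zero_iff_right hk.ne']

theorem mem_ellipseInterior_iff (z : ℝ × ℝ) :
    frame C ω ha hb z ∈ ellipseInterior F₁ F₂ s ↔ z.1 ^ 2 + z.2 ^ 2 < 1 := by
  obtain ⟨k, hk, heq⟩ := h.exists_pos_mul_eq hab ha hb z
  rw [ellipseInterior, Set.mem_ofPred_eq, ← sub_neg, ← sub_neg (b := (1 : ℝ)), ← heq]
  exact ⟨fun h' => mul_neg_of_neg_of_pos h' hk, fun h' => neg_of_mul_neg_left h' hk.le⟩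

end FocalFrame

theorem poncelet_porism {F₁ F₂ G₁ G₂ : Plane} {s t : ℝ} (hs : dist F₁ F₂ < s)
    (ht : dist G₁ G₂ < t) (hin : ellipse G₁ G₂ t ⊆ ellipseInterior F₁ F₂ s) {x y : ℕ → Plane}
    (hx : IsPonceletLine (ellipse F₁ F₂ s) (ellipse G₁ G₂ t) x)
    (hy : IsPonceletLine (ellipse F₁ F₂ s) (ellipse G₁ G₂ t) y) {n : ℕ} (hn : x n = x 0) :
    Function.Periodic y n := by
  obtain ⟨C, ω, c, hF⟩ := exists_focalFrame F₁ F₂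
  obtain ⟨D, χ, d, hG⟩ := exists_focalFrame G₁ G₂
  obtain ⟨A, B, hB, hAB⟩ := exists_hasSemiAxes hF.nonneg (hF.dist_eq ▸ hs)
  obtain ⟨a, b, hb, hab⟩ := exists_hasSemiAxes hG.nonneg (hG.dist_eq ▸ ht)
  have hΨ := hF.isUnitChart hAB (hAB.pos hF.nonneg).ne' hB.ne'
  have hΦ := hG.isUnitChart hab (hab.pos hG.nonneg).ne' hb.ne'
  refine hx.periodic_of_chart hΦ hΨ (fun θ => ?_) hy hn
  rw [← hF.mem_ellipseInterior_iff hAB (hAB.pos hF.nonneg).ne' hB.ne', AffineEquiv.apply_symm_apply]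
  exact hin ((hΦ _).2 θ.cos_sq_add_sin_sq)

/-! ### The optical property of confocal ellipses -/

/-- `ellipsePoint a b θ` is the point with eccentric angle `θ` on the ellipse with semi-axes
`a`, `b`, in coordinates along the axes. -/
def ellipsePoint (a b : ℝ) (θ : Angle) : ℝ × ℝ := (a * θ.cos, b * θ.sin)

/-- The derivative of `ellipsePoint a b` at `θ`; it directs the tangent. -/
def ellipseTangent (a b : ℝ) (θ : Angle) : ℝ × ℝ := (a * -θ.sin, b * θ.cos)

/-- The component of `v` along `τ`, times the length of `τ`. -/
def tangentialPart (τ v : ℝ × ℝ) : ℝ := τ.1 * v.1 + τ.2 * v.2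

/-- The component of `v` along the normal to the right of `τ`, times the length of `τ`. -/
def normalPart (τ v : ℝ × ℝ) : ℝ := τ.2 * v.1 - τ.1 * v.2

/-- The mirror image of `v` in the line spanned by `τ`. -/
def mirror (τ v : ℝ × ℝ) : ℝ × ℝ := (2 * tangentialPart τ v / (τ.1 ^ 2 + τ.2 ^ 2)) • τ - v

/-- The quadratic form in the direction `v` that vanishes when the line through `p` with direction
`v` is tangent to the ellipse with semi-axes `a` and `b`. -/
def causticForm (a b : ℝ) (p v : ℝ × ℝ) : ℝ :=
  a ^ 2 * v.2 ^ 2 + b ^ 2 * v.1 ^ 2 - (p.1 * v.2 - p.2 * v.1) ^ 2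

section

variable {τ v : ℝ × ℝ}

theorem tangentialPart_smul (r : ℝ) : tangentialPart τ (r • v) = r * tangentialPart τ v := by
  simp only [tangentialPart, Prod.smul_fst, Prod.smul_snd, smul_eq_mul]
  ring

theorem normalPart_smul (r : ℝ) : normalPart τ (r • v) = r * normalPart τ v := by
  simp only [normalPart, Prod.smul_fst, Prod.smul_snd, smul_eq_mul]
  ring

theorem tangentialPart_mirror (hτ : τ ≠ 0) :
    tangentialPart τ (mirror τ v) = tangentialPart τ v := by
  have hk : 2 * tangentialPart τ v / (τ.1 ^ 2 + τ.2 ^ 2) * (τ.1 ^ 2 + τ.2 ^ 2) =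
      2 * tangentialPart τ v := div_mul_cancel₀ _ (sq_add_sq_pos hτ).ne'
  unfold mirror
  generalize 2 * tangentialPart τ v / (τ.1 ^ 2 + τ.2 ^ 2) = k at hk ⊢
  simp only [tangentialPart, Prod.fst_sub, Prod.snd_sub, Prod.smul_fst, Prod.smul_snd,
    smul_eq_mul] at hk ⊢
  linear_combination hk

theorem normalPart_mirror : normalPart τ (mirror τ v) = -normalPart τ v := by
  simp only [normalPart, mirror, Prod.fst_sub, Prod.snd_sub, Prod.smul_fst, Prod.smul_snd,
    smul_eq_mul]
  ring

theorem eq_of_parts_eq (hτ : τ ≠ 0) {w : ℝ × ℝ} (ht : tangentialPart τ v = tangentialPart τ w)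
    (hn : normalPart τ v = normalPart τ w) : v = w := by
  have hτ' := (sq_add_sq_pos hτ).ne'
  unfold tangentialPart at ht
  unfold normalPart at hn
  exact Prod.ext (mul_left_cancel₀ hτ' (by linear_combination τ.1 * ht + τ.2 * hn))
    (mul_left_cancel₀ hτ' (by linear_combination τ.2 * ht - τ.1 * hn))

theorem tangentialPart_mul_normalPart_sub (w : ℝ × ℝ) :
    tangentialPart τ v * normalPart τ w - normalPart τ v * tangentialPart τ w =
      (τ.1 ^ 2 + τ.2 ^ 2) * (w.1 * v.2 - w.2 * v.1) := by
  unfold tangentialPart normalPart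
  ring

theorem mirror_smul (r : ℝ) : mirror τ (r • v) = r • mirror τ v := by
  rw [mirror, mirror, tangentialPart_smul, smul_sub, smul_smul, mul_left_comm, mul_div_assoc]

theorem causticForm_smul (a b r : ℝ) (p : ℝ × ℝ) :
    causticForm a b p (r • v) = r ^ 2 * causticForm a b p v := by
  simp only [causticForm, Prod.smul_fst, Prod.smul_snd, smul_eq_mul]
  ring

theorem mul_sq_add_mul_sq_pos {x y : ℝ} (hx : 0 < x) (hy : 0 < y) (hv : v ≠ 0) :
    0 < x * v.1 ^ 2 + y * v.2 ^ 2 := by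
  refine (mul_pos (lt_min hx hy) (sq_add_sq_pos hv)).trans_le ?_
  rw [mul_add]
  gcongr
  exacts [min_le_left _ _, min_le_right _ _]

theorem mul_sin_sq_add_mul_cos_sq_pos {x y : ℝ} (hx : 0 < x) (hy : 0 < y) (θ : Angle) :
    0 < x * θ.sin ^ 2 + y * θ.cos ^ 2 := by
  simpa only [tangentDir, neg_sq] using mul_sq_add_mul_sq_pos hx hy (tangentDir_ne_zero θ)

end

theorem reflection_rotLin (ω : Angle) (τ v : ℝ × ℝ) :
    (Submodule.span ℝ {rotLin ω τ}).reflection (rotLin ω v) = rotLin ω (mirror τ v) := by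
  rw [Submodule.reflection_singleton_apply, inner_rotLin, RCLike.ofReal_real_eq_id, id,
    norm_rotLin, sq_sqrt (by positivity), mirror, map_sub, map_smul, ← Nat.cast_smul_eq_nsmul ℝ,
    smul_smul, mul_div_assoc, Nat.cast_ofNat, tangentialPart]

theorem isTangent_frame_iff {C : Plane} {ω : Angle} {a b : ℝ} {ha : a ≠ 0} {hb : b ≠ 0}
    {E : Set Plane} (hE : IsUnitChart (frame C ω ha hb) E) (p : ℝ × ℝ) {v : ℝ × ℝ} (hv : v ≠ 0) :
    IsTangent E (AffineSubspace.mk' (rotLin ω p + C) (Submodule.span ℝ {rotLin ω v})) ↔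
      causticForm a b p v = 0 := by
  have hp : rotLin ω p + C = frame C ω ha hb (p.1 / a, p.2 / b) := by
    rw [frame_apply, mul_div_cancel₀ _ ha, mul_div_cancel₀ _ hb]
  have hv' : rotLin ω v = (frame C ω ha hb).linear (v.1 / a, v.2 / b) := by
    rw [frame_linear_apply, mul_div_cancel₀ _ ha, mul_div_cancel₀ _ hb]
  have hne : ((v.1 / a, v.2 / b) : ℝ × ℝ) ≠ 0 := by
    rw [← map_ne_zero_iff _ (frame C ω ha hb).linear.injective, ← hv']
    exact (map_ne_zero_iff _ (rotLin ω).injective).2 hv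
  rw [hp, hv', isTangent_mk'_span_iff hE _ hne, causticForm, ← sub_eq_zero]
  field_simp
  ring_nf

/-- `a`, `b` and `A`, `B` are the semi-axes of two ellipses with half focal distance `c`, the first
inside the second. The sign of `b` is left open. -/
structure IsConfocalNested (c a b A B : ℝ) : Prop where
  nonneg : 0 ≤ c
  lt_inner : c < a
  inner_lt : a < A
  inner_sq_eq : b ^ 2 = a ^ 2 - c ^ 2
  outer_sq_eq : B ^ 2 = A ^ 2 - c ^ 2
  outer_pos : 0 < B

namespace IsConfocalNested

variable {c a b A B : ℝ} (h : IsConfocalNested c a b A B)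
include h

theorem a_pos : 0 < a := h.nonneg.trans_lt h.lt_inner

theorem A_pos : 0 < A := h.a_pos.trans h.inner_lt

theorem b_sq_pos : 0 < b ^ 2 := by nlinarith [h.inner_sq_eq, h.nonneg, h.lt_inner]

theorem b_ne_zero : b ≠ 0 := (pow_ne_zero_iff two_ne_zero).1 h.b_sq_pos.ne'

theorem sq_sub_sq_pos : 0 < A ^ 2 - a ^ 2 := by nlinarith [h.a_pos, h.inner_lt]

theorem ellipseTangent_ne_zero (ψ : Angle) : ellipseTangent A B ψ ≠ 0 := fun h₀ =>
  tangentDir_ne_zero ψ <| Prod.ext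
    ((mul_eq_zero_iff_left h.A_pos.ne').1 (congrArg Prod.fst h₀))
    ((mul_eq_zero_iff_left h.outer_pos.ne').1 (congrArg Prod.snd h₀))

theorem mul_causticForm (ψ : Angle) (v : ℝ × ℝ) :
    ((ellipseTangent A B ψ).1 ^ 2 + (ellipseTangent A B ψ).2 ^ 2) *
        causticForm a b (ellipsePoint A B ψ) v =
      (a ^ 2 * ψ.sin ^ 2 + b ^ 2 * ψ.cos ^ 2) * normalPart (ellipseTangent A B ψ) v ^ 2 -
        (A ^ 2 - a ^ 2) * tangentialPart (ellipseTangent A B ψ) v ^ 2 := by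
  have hconf : b ^ 2 = B ^ 2 - (A ^ 2 - a ^ 2) := by
    rw [h.inner_sq_eq, h.outer_sq_eq]; ring
  simp only [ellipseTangent, ellipsePoint, causticForm, normalPart, tangentialPart]
  rw [hconf]
  linear_combination ((A ^ 2 - a ^ 2) * (B * ψ.cos * v.1 + A * ψ.sin * v.2) ^ 2 -
    (A ^ 2 * ψ.sin ^ 2 + B ^ 2 * ψ.cos ^ 2) * (A ^ 2 * v.2 ^ 2 + B ^ 2 * v.1 ^ 2)) *
      ψ.cos_sq_add_sin_sq

theorem mul_normalPart_sq {ψ : Angle} {v : ℝ × ℝ}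
    (hv : causticForm a b (ellipsePoint A B ψ) v = 0) :
    (a ^ 2 * ψ.sin ^ 2 + b ^ 2 * ψ.cos ^ 2) * normalPart (ellipseTangent A B ψ) v ^ 2 =
      (A ^ 2 - a ^ 2) * tangentialPart (ellipseTangent A B ψ) v ^ 2 := by
  rw [← sub_eq_zero, ← h.mul_causticForm, hv, mul_zero]

theorem normalPart_ne_zero {ψ : Angle} {v : ℝ × ℝ} (hv₀ : v ≠ 0)
    (hv : causticForm a b (ellipsePoint A B ψ) v = 0) :
    normalPart (ellipseTangent A B ψ) v ≠ 0 := by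
  intro hn
  have ht := h.mul_normalPart_sq hv
  rw [hn, zero_pow two_ne_zero, mul_zero, zero_eq_mul,
    or_iff_right h.sq_sub_sq_pos.ne', sq_eq_zero_iff] at ht
  exact hv₀ (eq_of_parts_eq (h.ellipseTangent_ne_zero ψ) (by rw [ht]; simp [tangentialPart])
    (by rw [hn]; simp [normalPart]))

theorem tangentialPart_ne_zero {ψ : Angle} {v : ℝ × ℝ} (hv₀ : v ≠ 0)
    (hv : causticForm a b (ellipsePoint A B ψ) v = 0) :
    tangentialPart (ellipseTangent A B ψ) v ≠ 0 := by
  have := mul_pos (mul_sin_sq_add_mul_cos_sq_pos (pow_pos h.a_pos 2) h.b_sq_pos ψ)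
    (sq_pos_of_ne_zero (h.normalPart_ne_zero hv₀ hv))
  rw [h.mul_normalPart_sq hv] at this
  exact (pow_ne_zero_iff two_ne_zero).1 (pos_of_mul_pos_right this h.sq_sub_sq_pos.le).ne'

theorem causticForm_mirror (ψ : Angle) (v : ℝ × ℝ) :
    causticForm a b (ellipsePoint A B ψ) (mirror (ellipseTangent A B ψ) v) =
      causticForm a b (ellipsePoint A B ψ) v := by
  have hτ := h.ellipseTangent_ne_zero ψ
  refine mul_left_cancel₀ (sq_add_sq_pos hτ).ne' ?_
  rw [h.mul_causticForm, h.mul_causticForm, normalPart_mirror, tangentialPart_mirror hτ, neg_sq]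

theorem mirror_ne_smul {ψ : Angle} {v : ℝ × ℝ} (hv₀ : v ≠ 0)
    (hv : causticForm a b (ellipsePoint A B ψ) v = 0) (r : ℝ) :
    mirror (ellipseTangent A B ψ) v ≠ r • v := by
  intro heq
  have ht : 1 = r := mul_right_cancel₀ (h.tangentialPart_ne_zero hv₀ hv) <| by
    rw [one_mul, ← tangentialPart_smul, ← heq, tangentialPart_mirror (h.ellipseTangent_ne_zero ψ)]
  have hn : -1 = r := mul_right_cancel₀ (h.normalPart_ne_zero hv₀ hv) <| by
    rw [neg_one_mul, ← normalPart_smul, ← heq, normalPart_mirror]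
  linarith

/-- Through a point of the outer ellipse there are two tangents of the inner one, and they are
exchanged by the reflection. -/
theorem exists_mirror_eq_smul {ψ : Angle} {v w : ℝ × ℝ}
    (hv : causticForm a b (ellipsePoint A B ψ) v = 0)
    (hw : causticForm a b (ellipsePoint A B ψ) w = 0) (hdet : v.1 * w.2 - v.2 * w.1 ≠ 0)
    (hnv : 0 < normalPart (ellipseTangent A B ψ) v)
    (hnw : normalPart (ellipseTangent A B ψ) w < 0) :
    ∃ μ : ℝ, 0 < μ ∧ mirror (ellipseTangent A B ψ) v = μ • w := by
  have hτ := h.ellipseTangent_ne_zero ψ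
  have hsq := h.mul_normalPart_sq hv
  have hsq' := h.mul_normalPart_sq hw
  set τ := ellipseTangent A B ψ
  have hdet' : tangentialPart τ v * normalPart τ w - normalPart τ v * tangentialPart τ w ≠ 0 := by
    rw [tangentialPart_mul_normalPart_sub]
    refine mul_ne_zero (sq_add_sq_pos hτ).ne' fun h₀ => hdet ?_
    linear_combination -h₀
  have hprod : (tangentialPart τ v * normalPart τ w - normalPart τ v * tangentialPart τ w) *
      (tangentialPart τ v * normalPart τ w + normalPart τ v * tangentialPart τ w) = 0 :=
    mul_left_cancel₀ h.sq_sub_sq_pos.ne' <| by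
      linear_combination normalPart τ v ^ 2 * hsq' - normalPart τ w ^ 2 * hsq
  have hsum := (mul_eq_zero_iff_left hdet').1 hprod
  have hμ : -normalPart τ v / normalPart τ w * normalPart τ w = -normalPart τ v :=
    div_mul_cancel₀ _ hnw.ne
  refine ⟨-normalPart τ v / normalPart τ w, div_pos_of_neg_of_neg (neg_neg_of_pos hnv) hnw,
    eq_of_parts_eq hτ ?_ ?_⟩
  · rw [tangentialPart_mirror hτ, tangentialPart_smul, div_mul_eq_mul_div, eq_div_iff hnw.ne]
    linear_combination hsum
  · rw [normalPart_mirror, normalPart_smul, hμ]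

end IsConfocalNested

section

variable {C : Plane} {ω : Angle} {A B : ℝ} {hA : A ≠ 0} {hB : B ≠ 0} {E : Set Plane}

theorem reflection_direction_chartTangent (ψ : Angle) (u : ℝ × ℝ) :
    (chartTangent (frame C ω hA hB) ψ).direction.reflection (rotLin ω u) =
      rotLin ω (mirror (ellipseTangent A B ψ) u) := by
  have hdir : (chartTangent (frame C ω hA hB) ψ).direction =
      Submodule.span ℝ {rotLin ω (ellipseTangent A B ψ)} := by
    rw [chartTangent, AffineSubspace.direction_mk', frame_linear_apply]; rfl
  simp only [hdir, reflection_rotLin]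

theorem reflects_frame_iff (hE : IsUnitChart (frame C ω hA hB) E) {ψ : Angle} {u : ℝ × ℝ}
    {w : Plane} : Reflects E (rotLin ω (ellipsePoint A B ψ) + C) (rotLin ω u) w ↔
      SameRay ℝ (rotLin ω (mirror (ellipseTangent A B ψ) u)) w := by
  constructor
  · rintro ⟨L, hL, hr⟩
    obtain ⟨χ, hχ, rfl⟩ := hL.exists_angle hE
    obtain rfl : ψ = χ := circlePoint_injective ((frame C ω hA hB).injective hχ)
    rwa [← reflection_direction_chartTangent]
  · intro hr
    refine ⟨chartTangent (frame C ω hA hB) ψ, isTangentAt_chartTangent hE ψ, ?_⟩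
    rwa [reflection_direction_chartTangent]

theorem Reflects.exists_smul_mirror (hE : IsUnitChart (frame C ω hA hB) E) {y u w : Plane}
    (hr : Reflects E y u w) (hu : u ≠ 0) (hw : w ≠ 0) : ∃ ψ v, ∃ r : ℝ, 0 < r ∧
      y = rotLin ω (ellipsePoint A B ψ) + C ∧ u = rotLin ω v ∧
      w = rotLin ω (r • mirror (ellipseTangent A B ψ) v) := by
  obtain ⟨ψ, rfl⟩ : ∃ ψ, y = rotLin ω (ellipsePoint A B ψ) + C := by
    obtain ⟨L, hL, -⟩ := hr
    exact (hL.exists_angle hE).imp fun ψ hψ => hψ.1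
  obtain ⟨v, rfl⟩ := (rotLin ω).surjective u
  have hm : rotLin ω (mirror (ellipseTangent A B ψ) v) ≠ 0 := by
    rw [← reflection_rotLin]
    exact (map_ne_zero_iff _ (LinearIsometryEquiv.injective _)).2 hu
  obtain ⟨r, hr₀, rfl⟩ := ((reflects_frame_iff hE).1 hr).exists_pos_left hm hw
  exact ⟨ψ, v, r, hr₀, rfl, rfl, (map_smul _ _ _).symm⟩

end

namespace IsConfocalNested

variable {c a b A B : ℝ} (h : IsConfocalNested c a b A B) {C : Plane} {ω : Angle} {D E : Set Plane}
include h

theorem reflects_isTangent_iff (hD : IsUnitChart (frame C ω h.a_pos.ne' h.b_ne_zero) D)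
    (hE : IsUnitChart (frame C ω h.A_pos.ne' h.outer_pos.ne') E) {y u w : Plane}
    (hr : Reflects E y u w) (hu : u ≠ 0) (hw : w ≠ 0) :
    IsTangent D (AffineSubspace.mk' y (Submodule.span ℝ {w})) ↔
      IsTangent D (AffineSubspace.mk' y (Submodule.span ℝ {u})) := by
  obtain ⟨ψ, v, r, hr₀, rfl, rfl, rfl⟩ := hr.exists_smul_mirror hE hu hw
  rw [isTangent_frame_iff hD _ ((map_ne_zero_iff _ (rotLin ω).injective).1 hu),
    isTangent_frame_iff hD _ ((map_ne_zero_iff _ (rotLin ω).injective).1 hw), causticForm_smul,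
    h.causticForm_mirror, mul_eq_zero_iff_left (pow_pos hr₀ 2).ne']

theorem reflects_ne_smul (hD : IsUnitChart (frame C ω h.a_pos.ne' h.b_ne_zero) D)
    (hE : IsUnitChart (frame C ω h.A_pos.ne' h.outer_pos.ne') E) {y u w : Plane}
    (hr : Reflects E y u w) (hu : u ≠ 0) (hw : w ≠ 0)
    (ht : IsTangent D (AffineSubspace.mk' y (Submodule.span ℝ {u}))) (k : ℝ) : w ≠ k • u := by
  obtain ⟨ψ, v, r, hr₀, rfl, rfl, rfl⟩ := hr.exists_smul_mirror hE hu hw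
  have hv : v ≠ 0 := (map_ne_zero_iff _ (rotLin ω).injective).1 hu
  rw [← map_smul, (rotLin ω).injective.ne_iff]
  intro heq
  refine h.mirror_ne_smul hv ((isTangent_frame_iff hD _ hv).1 ht) (r⁻¹ * k) ?_
  rw [mul_smul, ← heq, inv_smul_smul₀ hr₀.ne']

end IsConfocalNested

theorem HasSemiAxes.isConfocalNested {c s t a b A B : ℝ} (hc : 0 ≤ c) (hab : HasSemiAxes c t a b)
    (hAB : HasSemiAxes c s A B) (hB : 0 < B) (hts : t < s) : IsConfocalNested c a b A B :=
  ⟨hc, hab.lt, by linarith [hab.two_mul, hAB.two_mul], hab.sq_eq, hAB.sq_eq, hB⟩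

theorem exists_isConfocalNested {F₁ F₂ : Plane} {s t : ℝ} (ht : dist F₁ F₂ < t) (hts : t < s) :
    ∃ C ω c a b A B, ∃ h : IsConfocalNested c a b A B,
      IsUnitChart (frame C ω h.a_pos.ne' h.b_ne_zero) (ellipse F₁ F₂ t) ∧
        IsUnitChart (frame C ω h.A_pos.ne' h.outer_pos.ne') (ellipse F₁ F₂ s) := by
  obtain ⟨C, ω, c, hF⟩ := exists_focalFrame F₁ F₂
  obtain ⟨a, b, -, hab⟩ := exists_hasSemiAxes hF.nonneg (hF.dist_eq ▸ ht)
  obtain ⟨A, B, hB, hAB⟩ := exists_hasSemiAxes hF.nonneg (hF.dist_eq ▸ ht.trans hts)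
  have h := hab.isConfocalNested hF.nonneg hAB hB hts
  exact ⟨C, ω, c, a, b, A, B, h, hF.isUnitChart hab _ _, hF.isUnitChart hAB _ _⟩

/-! ### Billiard trajectories -/

theorem mk'_span_sub_comm {V : Type*} [AddCommGroup V] [Module ℝ V] (x y : V) :
    AffineSubspace.mk' y (Submodule.span ℝ {y - x}) =
      AffineSubspace.mk' x (Submodule.span ℝ {y - x}) := by
  have h : y ∈ AffineSubspace.mk' x (Submodule.span ℝ {y - x}) := mem_mk'_span.2 ⟨1, by simp⟩
  rw [← AffineSubspace.mk'_eq h, AffineSubspace.direction_mk']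

section

variable {F₁ F₂ : Plane} {s t : ℝ}

theorem IsBilliardTrajectory.isPonceletLine (ht : dist F₁ F₂ < t) (hts : t < s) {x : ℕ → Plane}
    (hx : IsBilliardTrajectory (ellipse F₁ F₂ s) x)
    (hxt : IsTangentTrajectory (ellipse F₁ F₂ t) x) :
    IsPonceletLine (ellipse F₁ F₂ s) (ellipse F₁ F₂ t) x := by
  obtain ⟨C, ω, c, a, b, A, B, h, hD, hE⟩ := exists_isConfocalNested ht hts
  obtain ⟨hxE, hne, hr⟩ := hx
  have hne' i : x (i + 1) - x i ≠ 0 := sub_ne_zero.2 (hne i)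
  let Tangent (i : ℕ) : Prop :=
    IsTangent (ellipse F₁ F₂ t) (AffineSubspace.mk' (x i) (Submodule.span ℝ {x (i + 1) - x i}))
  have hstep i : Tangent (i + 1) ↔ Tangent i := by
    simp only [Tangent, ← mk'_span_sub_comm (x i)]
    exact h.reflects_isTangent_iff hD hE (hr i) (hne' i) (hne' (i + 1))
  have hzero i : Tangent i ↔ Tangent 0 := by
    induction i with
    | zero => rfl
    | succ i ih => exact (hstep i).trans ih
  obtain ⟨j, hj⟩ := hxt
  have htan i : Tangent i := (hzero i).2 ((hzero j).1 hj)
  refine ⟨hxE, hne, htan, fun i heq => h.reflects_ne_smul hD hE (hr i) (hne' i) (hne' (i + 1))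
    (by rw [mk'_span_sub_comm]; exact htan i) (-1) ?_⟩
  rw [heq, neg_one_smul, neg_sub]

theorem IsTangent.notMem_ellipseInterior (ht : dist F₁ F₂ < t) {L : AffineSubspace ℝ Plane}
    (hL : IsTangent (ellipse F₁ F₂ t) L) {p : Plane} (hp : p ∈ L) :
    p ∉ ellipseInterior F₁ F₂ t := by
  obtain ⟨C, ω, c, hF⟩ := exists_focalFrame F₁ F₂
  obtain ⟨a, b, hb, hab⟩ := exists_hasSemiAxes hF.nonneg (hF.dist_eq ▸ ht)
  obtain ⟨θ, rfl⟩ :=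
    (isTangent_iff_exists_angle (hF.isUnitChart hab (hab.pos hF.nonneg).ne' hb.ne')).1 hL
  obtain ⟨r, rfl⟩ := mem_chartTangent.1 hp
  rw [hF.mem_ellipseInterior_iff hab, tangentPoint_sq_add_sq, not_lt]
  exact le_add_of_nonneg_right (sq_nonneg r)

theorem IsTangent.lt_of_chord (ht : dist F₁ F₂ < t) {x y : Plane} (hx : x ∈ ellipse F₁ F₂ s)
    (hy : y ∈ ellipse F₁ F₂ s) (hxy : y ≠ x)
    (h : IsTangent (ellipse F₁ F₂ t) (AffineSubspace.mk' x (Submodule.span ℝ {y - x}))) :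
    t < s := by
  have hxL : x ∈ AffineSubspace.mk' x (Submodule.span ℝ {y - x}) := AffineSubspace.self_mem_mk' _ _
  have hyL : y ∈ AffineSubspace.mk' x (Submodule.span ℝ {y - x}) := mem_mk'_span.2 ⟨1, by simp⟩
  refine lt_of_le_of_ne (not_lt.1 fun hlt => ?_) ?_
  · exact h.notMem_ellipseInterior ht hxL (hx.trans_lt hlt)
  · rintro rfl
    obtain ⟨z, -, hz⟩ := h
    exact hxy ((hz.subset ⟨hyL, hy⟩).trans (hz.subset ⟨hxL, hx⟩).symm)

theorem IsTangentTrajectory.lt (ht : dist F₁ F₂ < t) {x : ℕ → Plane}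
    (hxt : IsTangentTrajectory (ellipse F₁ F₂ t) x)
    (hx : IsBilliardTrajectory (ellipse F₁ F₂ s) x) : t < s := by
  obtain ⟨i, hi⟩ := hxt
  exact hi.lt_of_chord ht (hx.1 i) (hx.1 (i + 1)) (hx.2.1 i)

theorem billiard_porism (ht : dist F₁ F₂ < t) {x y : ℕ → Plane}
    (hx : IsBilliardTrajectory (ellipse F₁ F₂ s) x)
    (hxt : IsTangentTrajectory (ellipse F₁ F₂ t) x)
    (hy : IsBilliardTrajectory (ellipse F₁ F₂ s) y)
    (hyt : IsTangentTrajectory (ellipse F₁ F₂ t) y) {n : ℕ} (hn : x n = x 0) :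
    Function.Periodic y n := by
  have hts : t < s := hxt.lt ht hx
  exact poncelet_porism (ht.trans hts) ht (fun p hp => hp.trans_lt hts)
    (hx.isPonceletLine ht hts hxt) (hy.isPonceletLine ht hts hyt) hn

end

/-! ### The billiard ball map on the tangent lines of a confocal ellipse -/

/-- The ellipse with major semi-axis `A` and half focal distance `c`, in the chart in which the
confocal ellipse with major semi-axis `a` is the unit circle. -/
def confocalConic (c a A : ℝ) : Conic where
  a := a ^ 2 / A ^ 2
  b := 0
  c := (a ^ 2 - c ^ 2) / (A ^ 2 - c ^ 2)
  d := 0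
  e := 0
  f := -1

/-- The Poncelet maps of all the confocal ellipses around the ellipse with major semi-axis `a` and
half focal distance `c` preserve `dθ / confocalDensity c a θ`. -/
def confocalDensity (c a : ℝ) (θ : Angle) : ℝ := √(a ^ 2 * θ.sin ^ 2 + (a ^ 2 - c ^ 2) * θ.cos ^ 2)

theorem continuous_confocalDensity (c a : ℝ) : Continuous (confocalDensity c a) := by
  have hcos := Angle.continuous_cos
  have hsin := Angle.continuous_sin
  unfold confocalDensity
  fun_prop

theorem confocalDensity_pos {c a : ℝ} (hc : 0 ≤ c) (hca : c < a) (θ : Angle) :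
    0 < confocalDensity c a θ :=
  sqrt_pos.2 (mul_sin_sq_add_mul_cos_sq_pos (pow_pos (hc.trans_lt hca) 2)
    (sub_pos.2 (pow_lt_pow_left₀ hca hc two_ne_zero)) θ)

theorem causticForm_ellipseTangent {a b : ℝ} {p : ℝ × ℝ} {θ : Angle} {r : ℝ}
    (hp : p = (a * (tangentPoint θ r).1, b * (tangentPoint θ r).2)) :
    causticForm a b p (ellipseTangent a b θ) = 0 := by
  simp only [hp, causticForm, ellipseTangent, tangentPoint, circlePoint, tangentDir, Prod.smul_mk,
    Prod.mk_add_mk, smul_eq_mul]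
  linear_combination -(a ^ 2 * b ^ 2) * (θ.cos ^ 2 + θ.sin ^ 2) * θ.cos_sq_add_sin_sq

theorem det_ellipseTangent_add (a b : ℝ) (θ α : Angle) :
    (ellipseTangent a b θ).1 * (ellipseTangent a b (θ + α)).2 -
      (ellipseTangent a b θ).2 * (ellipseTangent a b (θ + α)).1 = a * b * α.sin := by
  simp only [ellipseTangent, Angle.cos_add, Angle.sin_add]
  linear_combination a * b * α.sin * θ.cos_sq_add_sin_sq

namespace IsConfocalNested

variable {c a b A B : ℝ} (h : IsConfocalNested c a b A B)
include h

theorem surrounds_confocalConic : (confocalConic c a A).Surrounds := by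
  have ha := pow_pos h.a_pos 2
  have hA := pow_pos h.A_pos 2
  have hb := h.b_sq_pos
  have hB := pow_pos h.outer_pos 2
  have hlt := h.sq_sub_sq_pos
  rw [h.inner_sq_eq] at hb
  rw [h.outer_sq_eq] at hB
  constructor
  · intro v hv
    simpa [Conic.quadPart, confocalConic] using
      mul_sq_add_mul_sq_pos (div_pos ha hA) (div_pos hb hB) hv
  · intro θ
    have := mul_sin_sq_add_mul_cos_sq_pos
      (sub_pos.2 ((div_lt_one hB).2 (by linarith : a ^ 2 - c ^ 2 < A ^ 2 - c ^ 2)))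
      (sub_pos.2 ((div_lt_one hA).2 (by linarith : a ^ 2 < A ^ 2))) θ
    simp only [Conic.eval, confocalConic, circlePoint]
    linarith [θ.cos_sq_add_sin_sq]

theorem disc_confocalConic (θ : Angle) :
    (confocalConic c a A).disc θ = (A ^ 2 - a ^ 2) / (A ^ 2 * (A ^ 2 - c ^ 2)) *
      (a ^ 2 * θ.sin ^ 2 + (a ^ 2 - c ^ 2) * θ.cos ^ 2) := by
  have hA := h.A_pos.ne'
  have hB : A ^ 2 - c ^ 2 ≠ 0 := h.outer_sq_eq ▸ (pow_pos h.outer_pos 2).ne'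
  have hdisc : (confocalConic c a A).disc θ =
      a ^ 2 / A ^ 2 * (1 - (a ^ 2 - c ^ 2) / (A ^ 2 - c ^ 2)) * θ.sin ^ 2 +
        (a ^ 2 - c ^ 2) / (A ^ 2 - c ^ 2) * (1 - a ^ 2 / A ^ 2) * θ.cos ^ 2 := by
    simp only [Conic.disc, Conic.quadPart, Conic.halfDeriv, Conic.eval, confocalConic, circlePoint,
      tangentDir]
    linear_combination -(a ^ 2 / A ^ 2 * ((a ^ 2 - c ^ 2) / (A ^ 2 - c ^ 2)) *
      (θ.cos ^ 2 + θ.sin ^ 2)) * θ.cos_sq_add_sin_sq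
  rw [hdisc]
  field_simp
  ring

theorem preservesDensity_next_confocalConic :
    PreservesDensity (confocalDensity c a) (confocalConic c a A).next := by
  have hB : 0 < A ^ 2 - c ^ 2 := h.outer_sq_eq ▸ pow_pos h.outer_pos 2
  have hk : 0 < (A ^ 2 - a ^ 2) / (A ^ 2 * (A ^ 2 - c ^ 2)) :=
    div_pos h.sq_sub_sq_pos (mul_pos (pow_pos h.A_pos 2) hB)
  have hdensity : (confocalConic c a A).density =
      fun θ => √((A ^ 2 - a ^ 2) / (A ^ 2 * (A ^ 2 - c ^ 2))) * confocalDensity c a θ := by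
    ext θ
    rw [Conic.density, h.disc_confocalConic, sqrt_mul hk.le, confocalDensity]
  exact .of_const_mul (sqrt_pos.2 hk).ne' <|
    hdensity ▸ h.surrounds_confocalConic.preservesDensity_next

theorem normalPart_ellipseTangent {ψ : Angle} {z : ℝ × ℝ}
    (hz : ellipsePoint A B ψ = (a * z.1, b * z.2)) (θ : Angle) :
    normalPart (ellipseTangent A B ψ) (ellipseTangent a b θ) =
      A * B * (confocalConic c a A).halfDeriv z (tangentDir θ) := by
  have hcos : A * ψ.cos = a * z.1 := congrArg Prod.fst hz
  have hsin : B * ψ.sin = b * z.2 := congrArg Prod.snd hz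
  have hA := h.A_pos.ne'
  have hB := h.outer_pos.ne'
  simp only [normalPart, ellipseTangent, tangentDir, Conic.halfDeriv, confocalConic,
    ← h.inner_sq_eq, ← h.outer_sq_eq]
  field_simp
  linear_combination -(a * B ^ 2 * θ.sin) * hcos + A ^ 2 * b * θ.cos * hsin

/-- The optical property: a tangent of the inner ellipse is reflected, where it leaves the outer
one, into the next tangent. -/
theorem exists_mirror_ellipseTangent_eq_smul {θ ψ : Angle} (hψ : ellipsePoint A B ψ =
      (a * ((confocalConic c a A).exitPoint θ).1, b * ((confocalConic c a A).exitPoint θ).2)) :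
    ∃ μ : ℝ, 0 < μ ∧ mirror (ellipseTangent A B ψ) (ellipseTangent a b θ) =
      μ • ellipseTangent a b ((confocalConic c a A).next θ) := by
  have hq := h.surrounds_confocalConic
  have hAB := mul_pos h.A_pos h.outer_pos
  refine h.exists_mirror_eq_smul (causticForm_ellipseTangent hψ)
    (causticForm_ellipseTangent (r := -(confocalConic c a A).exitTime θ) ?_) ?_ ?_ ?_
  · rw [Conic.Surrounds.tangentPoint_next, hψ]
  · rw [Conic.next, det_ellipseTangent_add, Angle.sin_coe, sin_two_arctan]
    have := hq.exitTime_pos θ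
    have := h.a_pos.ne'
    have := h.b_ne_zero
    positivity
  · rw [h.normalPart_ellipseTangent hψ, hq.halfDeriv_exitPoint]
    exact mul_pos hAB (hq.density_pos θ)
  · rw [h.normalPart_ellipseTangent hψ, ← neg_eq_iff_eq_neg.2 (hq.density_next θ), mul_neg]
    exact neg_neg_of_pos (mul_pos hAB (hq.density_pos _))

theorem frame_mem_iff {C : Plane} {ω : Angle} {E : Set Plane}
    (hE : IsUnitChart (frame C ω h.A_pos.ne' h.outer_pos.ne') E) (z : ℝ × ℝ) :
    frame C ω h.a_pos.ne' h.b_ne_zero z ∈ E ↔ (confocalConic c a A).eval z = 0 := by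
  have hz : frame C ω h.a_pos.ne' h.b_ne_zero z =
      frame C ω h.A_pos.ne' h.outer_pos.ne' (a * z.1 / A, b * z.2 / B) := by
    rw [frame_apply, frame_apply, mul_div_cancel₀ _ h.A_pos.ne', mul_div_cancel₀ _ h.outer_pos.ne']
  rw [hz, hE, ← sub_eq_zero]
  simp only [confocalConic, Conic.eval, ← h.inner_sq_eq, ← h.outer_sq_eq, div_pow, mul_pow]
  ring_nf

end IsConfocalNested

namespace OrientedLine

theorem line_eq_of_mem (ℓ : OrientedLine) {y : Plane} (hy : y ∈ ℓ.line) :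
    ℓ.line = AffineSubspace.mk' y (Submodule.span ℝ {ℓ.dir}) := by
  obtain ⟨p, hp⟩ := ℓ.line_eq
  rw [← AffineSubspace.mk'_eq hy, hp, AffineSubspace.direction_mk']

theorem eq_iff_of_mem {ℓ m : OrientedLine} {y : Plane} (hy : y ∈ m.line) :
    ℓ = m ↔ y ∈ ℓ.line ∧ SameRay ℝ m.dir ℓ.dir := by
  constructor
  · rintro rfl
    exact ⟨hy, .rfl⟩
  · rintro ⟨hy', hr⟩
    have hdir : m.dir = ℓ.dir := hr.eq_of_norm_eq (by rw [m.norm_dir, ℓ.norm_dir])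
    exact OrientedLine.ext (by rw [ℓ.line_eq_of_mem hy', m.line_eq_of_mem hy, hdir]) hdir.symm

end OrientedLine

theorem billiardMap_eq {E : Set Plane} {ℓ m : OrientedLine}
    (h : ∀ ℓ', BilliardStep E ℓ ℓ' ↔ ℓ' = m) : billiardMap E ℓ = m := by
  have hex : ∃ ℓ', BilliardStep E ℓ ℓ' := ⟨m, (h m).2 rfl⟩
  rw [billiardMap, dif_pos hex]
  exact (h _).1 hex.choose_spec

/-- The line `chartTangent Φ θ`, oriented in the direction of increasing `θ`. -/
def orientedTangent (Φ : (ℝ × ℝ) ≃ᵃ[ℝ] Plane) (θ : Angle) : OrientedLine where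
  line := chartTangent Φ θ
  dir := ‖Φ.linear (tangentDir θ)‖⁻¹ • Φ.linear (tangentDir θ)
  norm_dir := norm_smul_inv_norm (𝕜 := ℝ)
    ((map_ne_zero_iff _ Φ.linear.injective).2 (tangentDir_ne_zero θ))
  line_eq := by
    have h : Φ.linear (tangentDir θ) ≠ 0 :=
      (map_ne_zero_iff _ Φ.linear.injective).2 (tangentDir_ne_zero θ)
    exact ⟨Φ (circlePoint θ), by rw [chartTangent,
      Submodule.span_singleton_smul_eq (IsUnit.mk0 _ (inv_ne_zero (norm_ne_zero_iff.2 h)))]⟩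

section

variable {Φ : (ℝ × ℝ) ≃ᵃ[ℝ] Plane} {E : Set Plane}

theorem exists_orientedTangent_dir_eq (Φ : (ℝ × ℝ) ≃ᵃ[ℝ] Plane) (θ : Angle) :
    ∃ k : ℝ, 0 < k ∧ (orientedTangent Φ θ).dir = k • Φ.linear (tangentDir θ) :=
  ⟨_, inv_pos.2 (norm_pos_iff.2
    ((map_ne_zero_iff _ Φ.linear.injective).2 (tangentDir_ne_zero θ))), rfl⟩

theorem orientedTangent_injective (hΦ : IsUnitChart Φ E) :
    Function.Injective (orientedTangent Φ) := by
  intro θ α heq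
  have hline : chartTangent Φ θ = chartTangent Φ α := congrArg OrientedLine.line heq
  have hpoint := (isTangentAt_chartTangent hΦ θ).2
  rw [hline, (isTangentAt_chartTangent hΦ α).2, Set.singleton_eq_singleton_iff] at hpoint
  exact (circlePoint_injective (Φ.injective hpoint)).symm

variable {q : Conic} (hq : q.Surrounds) (hE : ∀ z, Φ z ∈ E ↔ q.eval z = 0)
include hq hE

theorem last_point_iff {θ : Angle} {y : Plane} :
    (y ∈ E ∧ y ∈ (orientedTangent Φ θ).line ∧
      ∀ r : ℝ, 0 < r → y + r • (orientedTangent Φ θ).dir ∉ E) ↔ y = Φ (q.exitPoint θ) := by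
  obtain ⟨k, hk, hdir⟩ := exists_orientedTangent_dir_eq Φ θ
  have hmove (r r' : ℝ) : Φ (tangentPoint θ r) + r' • (orientedTangent Φ θ).dir =
      Φ (tangentPoint θ (r + r' * k)) := by
    rw [hdir, smul_smul, ← affineEquiv_add_smul, tangentPoint, tangentPoint, add_assoc, add_smul]
  have hexit := hq.eval_exitPoint θ
  have hpos := hq.exitTime_pos θ
  constructor
  · rintro ⟨hyE, hyL, hlast⟩
    obtain ⟨r, rfl⟩ := mem_chartTangent.1 hyL
    rw [hE] at hyE
    by_contra hne
    have hr : r < 0 := neg_of_mul_neg_left (hq.mul_neg_of_eval_eq_zero hyE hexit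
      fun hr => hne (by rw [hr, Conic.exitPoint])) hpos.le
    refine hlast ((q.exitTime θ - r) / k) (div_pos (by linarith) hk) ?_
    rwa [hmove, div_mul_cancel₀ _ hk.ne', add_sub_cancel, hE]
  · rintro rfl
    refine ⟨(hE _).2 hexit, mem_chartTangent.2 ⟨_, rfl⟩, fun r hr hrE => ?_⟩
    rw [Conic.exitPoint, hmove, hE] at hrE
    have hrk := mul_pos hr hk
    have := hq.eq_of_mul_pos hrE hexit (mul_pos (add_pos hpos hrk) hpos)
    linarith

theorem billiardStep_orientedTangent_iff_reflects {θ : Angle} {ℓ : OrientedLine} :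
    BilliardStep E (orientedTangent Φ θ) ℓ ↔ Φ (q.exitPoint θ) ∈ ℓ.line ∧
      Reflects E (Φ (q.exitPoint θ)) (orientedTangent Φ θ).dir ℓ.dir := by
  constructor
  · rintro ⟨y, hyE, hy, hlast, h⟩
    obtain rfl := (last_point_iff hq hE).1 ⟨hyE, hy, hlast⟩
    exact h
  · intro h
    obtain ⟨hyE, hy, hlast⟩ := (last_point_iff hq hE (θ := θ)).2 rfl
    exact ⟨_, hyE, hy, hlast, h⟩

end

theorem sameRay_pos_smul_left_iff {V : Type*} [AddCommGroup V] [Module ℝ V] {r : ℝ} (hr : 0 < r)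
    {u w : V} : SameRay ℝ (r • u) w ↔ SameRay ℝ u w :=
  ⟨fun h => by simpa only [inv_smul_smul₀ hr.ne'] using h.pos_smul_left (inv_pos.2 hr),
    fun h => h.pos_smul_left hr⟩

namespace IsConfocalNested

variable {c a b A B : ℝ} (h : IsConfocalNested c a b A B) {C : Plane} {ω : Angle} {E : Set Plane}
  (hE : IsUnitChart (frame C ω h.A_pos.ne' h.outer_pos.ne') E)
include h hE

theorem reflects_orientedTangent_iff {θ : Angle} {w : Plane} :
    Reflects E (frame C ω h.a_pos.ne' h.b_ne_zero ((confocalConic c a A).exitPoint θ))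
        (orientedTangent (frame C ω h.a_pos.ne' h.b_ne_zero) θ).dir w ↔
      SameRay ℝ (orientedTangent (frame C ω h.a_pos.ne' h.b_ne_zero)
        ((confocalConic c a A).next θ)).dir w := by
  obtain ⟨ψ, hψ⟩ : ∃ ψ, ellipsePoint A B ψ =
      (a * ((confocalConic c a A).exitPoint θ).1, b * ((confocalConic c a A).exitPoint θ).2) := by
    have hmem := (h.frame_mem_iff hE _).2 (h.surrounds_confocalConic.eval_exitPoint θ)
    obtain ⟨z, hz⟩ := (frame C ω h.A_pos.ne' h.outer_pos.ne').surjective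
      (frame C ω h.a_pos.ne' h.b_ne_zero ((confocalConic c a A).exitPoint θ))
    obtain ⟨ψ, rfl⟩ := exists_circlePoint_eq ((hE z).1 (hz ▸ hmem))
    exact ⟨ψ, (rotLin ω).injective (add_right_cancel hz)⟩
  obtain ⟨μ, hμ, hmirror⟩ := h.exists_mirror_ellipseTangent_eq_smul hψ
  obtain ⟨k, hk, hdir⟩ := exists_orientedTangent_dir_eq (frame C ω h.a_pos.ne' h.b_ne_zero) θ
  obtain ⟨k', hk', hdir'⟩ := exists_orientedTangent_dir_eq (frame C ω h.a_pos.ne' h.b_ne_zero)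
    ((confocalConic c a A).next θ)
  have hu : k • (frame C ω h.a_pos.ne' h.b_ne_zero).linear (tangentDir θ) =
      rotLin ω (k • ellipseTangent a b θ) :=
    (map_smul (rotLin ω) k (ellipseTangent a b θ)).symm
  rw [frame_apply, ← hψ, hdir, hu, reflects_frame_iff hE, mirror_smul, hmirror, hdir', map_smul,
    map_smul, sameRay_pos_smul_left_iff hk, sameRay_pos_smul_left_iff hμ,
    sameRay_pos_smul_left_iff hk']
  rfl

theorem billiardStep_orientedTangent_iff {θ : Angle} {ℓ : OrientedLine} :
    BilliardStep E (orientedTangent (frame C ω h.a_pos.ne' h.b_ne_zero) θ) ℓ ↔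
      ℓ = orientedTangent (frame C ω h.a_pos.ne' h.b_ne_zero) ((confocalConic c a A).next θ) := by
  rw [billiardStep_orientedTangent_iff_reflects h.surrounds_confocalConic (h.frame_mem_iff hE),
    h.reflects_orientedTangent_iff hE, ← OrientedLine.eq_iff_of_mem]
  exact mem_chartTangent.2 ⟨_, by rw [Conic.Surrounds.tangentPoint_next]⟩

theorem semiconj_billiardMap :
    Function.Semiconj (orientedTangent (frame C ω h.a_pos.ne' h.b_ne_zero))
      (confocalConic c a A).next (billiardMap E) :=
  fun _ => (billiardMap_eq fun _ => h.billiardStep_orientedTangent_iff hE).symm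

end IsConfocalNested

theorem OrientedLine.eq_orientedTangent {Φ : (ℝ × ℝ) ≃ᵃ[ℝ] Plane} {ℓ : OrientedLine} {θ : Angle}
    (hline : ℓ.line = chartTangent Φ θ) (hdir : SameRay ℝ (Φ.linear (tangentDir θ)) ℓ.dir) :
    ℓ = orientedTangent Φ θ := by
  obtain ⟨k, hk, hdir'⟩ := exists_orientedTangent_dir_eq Φ θ
  have hmem : Φ (circlePoint θ) ∈ chartTangent Φ θ := AffineSubspace.self_mem_mk' _ _
  refine (OrientedLine.eq_iff_of_mem hmem).2 ⟨hline ▸ hmem, ?_⟩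
  rw [hdir']
  exact hdir.pos_smul_left hk

theorem OrientedLine.exists_dir_eq_smul {Φ : (ℝ × ℝ) ≃ᵃ[ℝ] Plane} {ℓ : OrientedLine} {θ : Angle}
    (hline : ℓ.line = chartTangent Φ θ) : ∃ r : ℝ, r • Φ.linear (tangentDir θ) = ℓ.dir := by
  obtain ⟨p, hp⟩ := ℓ.line_eq
  have hdir := congrArg AffineSubspace.direction (hp.symm.trans hline)
  rw [chartTangent, AffineSubspace.direction_mk', AffineSubspace.direction_mk'] at hdir
  exact Submodule.mem_span_singleton.1 (hdir ▸ Submodule.mem_span_singleton_self _)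

theorem frame_neg_linear_tangentDir (C : Plane) (ω : Angle) {a b : ℝ} (ha : a ≠ 0) (hb : b ≠ 0)
    (θ : Angle) : (frame C ω ha (neg_ne_zero.2 hb)).linear (tangentDir (-θ)) =
      -(frame C ω ha hb).linear (tangentDir θ) := by
  simp only [frame_linear_apply, tangentDir, ← map_neg, Angle.sin_neg, Angle.cos_neg, neg_neg,
    Prod.neg_mk, mul_neg, neg_mul]

theorem chartTangent_frame_neg (C : Plane) (ω : Angle) {a b : ℝ} (ha : a ≠ 0) (hb : b ≠ 0)
    (θ : Angle) : chartTangent (frame C ω ha (neg_ne_zero.2 hb)) (-θ) =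
      chartTangent (frame C ω ha hb) θ := by
  have hpoint : frame C ω ha (neg_ne_zero.2 hb) (circlePoint (-θ)) =
      frame C ω ha hb (circlePoint θ) := by
    simp only [frame_apply, circlePoint, Angle.sin_neg, Angle.cos_neg, neg_mul_neg]
  rw [chartTangent, hpoint, frame_neg_linear_tangentDir, ← Set.neg_singleton, Submodule.span_neg,
    chartTangent]

namespace FocalFrame

variable {F₁ F₂ C : Plane} {ω : Angle} {c t a b : ℝ} (hF : FocalFrame F₁ F₂ C ω c)

/-- The oriented tangents of the ellipse with major semi-axis `a` and signed minor semi-axis `b`.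
The charts of `b` and `-b` are mirror images, so that these two families together exhaust the
oriented tangents of the ellipse. -/
def tangentFamily (b : {b : ℝ // HasSemiAxes c t a b}) (θ : Angle) : OrientedLine :=
  orientedTangent (frame C ω (b.2.pos hF.nonneg).ne' (b.2.ne_zero hF.nonneg)) θ

theorem tangentFamily_injective (b : {b : ℝ // HasSemiAxes c t a b}) :
    Function.Injective (hF.tangentFamily b) :=
  orientedTangent_injective (hF.isUnitChart b.2 _ _)

theorem exists_eq_tangentFamily (hab : HasSemiAxes c t a b) {ℓ : OrientedLine}
    (hℓ : IsTangent (ellipse F₁ F₂ t) ℓ.line) :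
    ∃ (b' : {b : ℝ // HasSemiAxes c t a b}) (θ : Angle), ℓ = hF.tangentFamily b' θ := by
  have ha := (hab.pos hF.nonneg).ne'
  have hb := hab.ne_zero hF.nonneg
  obtain ⟨θ, hline⟩ := (isTangent_iff_exists_angle (hF.isUnitChart hab ha hb)).1 hℓ
  obtain ⟨r, hr⟩ := ℓ.exists_dir_eq_smul hline
  rcases le_total 0 r with h | h
  · exact ⟨⟨b, hab⟩, θ, ℓ.eq_orientedTangent hline (hr ▸ .sameRay_nonneg_smul_right _ h)⟩
  · refine ⟨⟨-b, hab.neg⟩, -θ, ℓ.eq_orientedTangent (hline.trans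
      (chartTangent_frame_neg C ω ha hb θ).symm) ?_⟩
    rw [frame_neg_linear_tangentDir C ω ha hb, ← hr, ← neg_smul_neg]
    exact .sameRay_nonneg_smul_right _ (neg_nonneg.2 h)

theorem preservesDensityAlong_billiardMap (hab : HasSemiAxes c t a b) {s : ℝ} (hs : t < s) :
    PreservesDensityAlong (confocalDensity c a)
      (hF.tangentFamily : {b : ℝ // HasSemiAxes c t a b} → _) (billiardMap (ellipse F₁ F₂ s)) := by
  obtain ⟨A, B, hB, hAB⟩ := exists_hasSemiAxes hF.nonneg (s := s)
    (by linarith [hab.lt, hab.two_mul])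
  have hN {b} (hab : HasSemiAxes c t a b) := hab.isConfocalNested hF.nonneg hAB hB hs
  exact ⟨_, (hN hab).preservesDensity_next_confocalConic, fun b =>
    (hN b.2).semiconj_billiardMap (hF.isUnitChart hAB _ _)⟩

theorem preservesDensityAlong_billiardComposition (hab : HasSemiAxes c t a b) {k : ℕ}
    {s : Fin k → ℝ} (hs : ∀ j, t < s j) :
    PreservesDensityAlong (confocalDensity c a)
      (hF.tangentFamily : {b : ℝ // HasSemiAxes c t a b} → _) (billiardComposition F₁ F₂ s) := by
  have hpos := confocalDensity_pos hF.nonneg hab.lt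
  refine List.foldlRecOn _ _ (.id hpos) fun f hf r hr => ?_
  obtain ⟨j, rfl⟩ := List.mem_ofFn.1 hr
  exact (hF.preservesDensityAlong_billiardMap hab (hs j)).comp hpos hf

end FocalFrame

theorem billiardComposition_porism {F₁ F₂ : Plane} {t : ℝ} (ht : dist F₁ F₂ < t) {k : ℕ}
    {s : Fin k → ℝ} (hs : ∀ j, t < s j) {ℓ ℓ' : OrientedLine}
    (hℓ : IsTangent (ellipse F₁ F₂ t) ℓ.line) (hℓ' : IsTangent (ellipse F₁ F₂ t) ℓ'.line) {n : ℕ}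
    (hn : Function.IsPeriodicPt (billiardComposition F₁ F₂ s) n ℓ) :
    Function.IsPeriodicPt (billiardComposition F₁ F₂ s) n ℓ' := by
  obtain ⟨C, ω, c, hF⟩ := exists_focalFrame F₁ F₂
  obtain ⟨a, b, -, hab⟩ := exists_hasSemiAxes hF.nonneg (hF.dist_eq ▸ ht)
  obtain ⟨σ, θ, rfl⟩ := hF.exists_eq_tangentFamily hab hℓ
  obtain ⟨σ', θ', rfl⟩ := hF.exists_eq_tangentFamily hab hℓ'
  have hpos := confocalDensity_pos hF.nonneg hab.lt
  exact ((hF.preservesDensityAlong_billiardComposition hab hs).iterate hpos n).isFixedPt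
    (continuous_confocalDensity c a) hpos hF.tangentFamily_injective hn σ' θ'

end

theorem corollary6 :
    -- one confocal ellipse as table
    (∀ (F₁ F₂ : Plane) (s t : ℝ), dist F₁ F₂ < s → dist F₁ F₂ < t →
      ∀ (n : ℕ) (x : ℕ → Plane), IsBilliardTrajectory (ellipse F₁ F₂ s) x →
        IsTangentTrajectory (ellipse F₁ F₂ t) x → Function.Periodic x n →
        ∀ y : ℕ → Plane, IsBilliardTrajectory (ellipse F₁ F₂ s) y →
          IsTangentTrajectory (ellipse F₁ F₂ t) y → Function.Periodic y n) ∧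
    -- several confocal ellipses around the caustic
    (∀ (F₁ F₂ : Plane) (t : ℝ) (k : ℕ) (s : Fin k → ℝ), dist F₁ F₂ < t → (∀ j, t < s j) →
      ∀ (n : ℕ) (ℓ : OrientedLine), IsTangent (ellipse F₁ F₂ t) ℓ.line →
        Function.IsPeriodicPt (billiardComposition F₁ F₂ s) n ℓ →
        ∀ ℓ' : OrientedLine, IsTangent (ellipse F₁ F₂ t) ℓ'.line →
          Function.IsPeriodicPt (billiardComposition F₁ F₂ s) n ℓ') ∧
    -- the Poncelet porism for two nested ellipses
    (∀ (F₁ F₂ G₁ G₂ : Plane) (s t : ℝ), dist F₁ F₂ < s → dist G₁ G₂ < t →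
      ellipse G₁ G₂ t ⊆ ellipseInterior F₁ F₂ s →
      ∀ (n : ℕ) (x : ℕ → Plane),
        IsPonceletLine (ellipse F₁ F₂ s) (ellipse G₁ G₂ t) x → x n = x 0 →
        ∀ y : ℕ → Plane,
          IsPonceletLine (ellipse F₁ F₂ s) (ellipse G₁ G₂ t) y → Function.Periodic y n) := by
  refine ⟨?_, ?_, ?_⟩
  · exact fun F₁ F₂ s t _ ht n x hx hxt hn y hy hyt => billiard_porism ht hx hxt hy hyt hn.eq
  · exact fun F₁ F₂ t k s ht hs n ℓ hℓ hn ℓ' hℓ' => billiardComposition_porism ht hs hℓ hℓ' hn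
  · exact fun F₁ F₂ G₁ G₂ s t hs ht hin n x hx hn y hy => poncelet_porism hs ht hin hx hy hn
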